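/- Let $M$ be a smooth $7$-manifold and let $\varphi$ be a closed $G_2$ structure on $M$: a smooth $3$-form with $d\varphi=0$ such that for every $x\in M$ there is a linear isomorphism $u:T_xM\to\mathbb R^7$ with $\varphi_x=u^*\phi$, where $\phi=e^{123}+e^{145}+e^{167}+e^{246}-e^{257}-e^{347}-e^{356}$. Let $g$ and $\mathrm{vol}_g$ be the associated Riemannian metric and its (oriented) volume form, determined by $$g(u,v)\,\mathrm{vol}_g=\tfrac16\,(u\lrcorner\varphi)\wedge(v\lrcorner\varphi)\wedge\varphi ,$$ let $*$ be their Hodge star, $\psi=*\varphi$, let $d^*=*d*$ be the codifferential on $2$-forms, and let ${}^\sharp$ be the identification of $1$-forms with vector fields by $g$. For a symmetric $2$-tensor $h$ let $i_\varphi(h)$ be the $3$-form with components $$i_\varphi(h)_{ijk}=h_i^{\,l}\varphi_{ljk}-h_j^{\,l}\varphi_{lik}-h_k^{\,l}\varphi_{lji},\qquad h_i^{\,l}=g^{lm}h_{mi}.$$ Then for every smooth vector field $X$ on $M$, $$\mathcal L_X\varphi=\tfrac12\, i_\varphi(\mathcal L_Xg)+\tfrac12\,\big(d^*(X\lrcorner\varphi)\big)^\sharp\lrcorner\psi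 .$$ Moreover, $X$ is a symmetry of $\varphi$ (that is, $\mathcal L_X\varphi=0$) if and only if $X$ is a Killing field of $g$ (that is, $\mathcal L_Xg=0$) and $d^*(X\lrcorner\varphi)=0$ on $M$. -/

import Mathlib

open scoped Manifold ContDiff

noncomputable section

namespace G2

/-! ### Linear algebra of alternating forms on a vector space `V` -/

section Linear

variable {V : Type*} [AddCommGroup V] [Module ℝ V] [TopologicalSpace V]

/-- The interior product `v ⌟ η`, i.e. `(v ⌟ η)(w₁, …, wₙ) = η(v, w₁, …, wₙ)`. -/
def contract {n : ℕ} (v : V) (η : V [⋀^Fin (n + 1)]→L[ℝ] ℝ) : V [⋀^Fin n]→L[ℝ] ℝ :=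
  { η.toAlternatingMap.curryLeft v with
    cont := η.cont.comp (continuous_const.matrixVecCons continuous_id) }

/-- Insertion of `p` vectors in the first `p` slots:
`(insert v η)(w₁, …, w_q) = η(v₁, …, v_p, w₁, …, w_q)`. -/
def insertVecs {q : ℕ} : (p : ℕ) → (Fin p → V) → (V [⋀^Fin (q + p)]→L[ℝ] ℝ) → V [⋀^Fin q]→L[ℝ] ℝ
  | 0, _, η => η
  | p + 1, v, η => insertVecs p (Fin.tail v) (contract (n := q + p) (v 0) η)

/-- The derivation action of an endomorphism `A` on a `k`-form:
`(A · η)(v₁, …, v_k) = ∑ᵢ η(v₁, …, A vᵢ, …, v_k)`. -/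
def derivAction {k : ℕ} (A : V →L[ℝ] V) (η : V [⋀^Fin k]→L[ℝ] ℝ) : V [⋀^Fin k]→L[ℝ] ℝ :=
  { (∑ i : Fin k, η.toContinuousMultilinearMap.compContinuousLinearMap
      (Function.update (fun _ => ContinuousLinearMap.id ℝ V) i A) :
      ContinuousMultilinearMap ℝ (fun _ : Fin k => V) ℝ) with
    map_eq_zero_of_eq' := by
      intro v i j hij hne
      have key : ∀ m : Fin k, (fun a => (Function.update (fun _ => ContinuousLinearMap.id ℝ V) m A :
          Fin k → V →L[ℝ] V) a (v a)) = Function.update v m (A (v m)) := by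
        intro m
        funext a
        by_cases h : a = m
        · subst h; simp
        · simp [h]
      have hsum : ∑ m : Fin k, η (Function.update v m (A (v m))) = 0 := by
        rw [← Finset.sum_subset (Finset.subset_univ {i, j})]
        · rw [Finset.sum_pair hne]
          have hsw : Function.update v j (A (v j)) =
              Function.update v i (A (v i)) ∘ Equiv.swap i j := by
            funext a
            by_cases hi : a = i
            · subst hi; simp [hne, hne.symm, hij]
            · by_cases hj : a = j
              · subst hj; simp [hij]
              · simp [hi, hj, Equiv.swap_apply_of_ne_of_ne hi hj]
          rw [hsw]
          have := η.toAlternatingMap.map_swap (Function.update v i (A (v i))) hne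
          simp only [ContinuousAlternatingMap.coe_toAlternatingMap] at this
          rw [this, add_neg_cancel]
        · intro m _ hm
          simp only [Finset.mem_insert, Finset.mem_singleton, not_or] at hm
          exact η.map_eq_zero_of_eq _
            (by rw [Function.update_of_ne (Ne.symm hm.1), Function.update_of_ne (Ne.symm hm.2), hij])
            hne
      simpa [sum_apply, key] using hsum }

theorem derivAction_apply {k : ℕ} (A : V →L[ℝ] V) (η : V [⋀^Fin k]→L[ℝ] ℝ) (v : Fin k → V) :
    derivAction A η v = ∑ i, η (Function.update v i (A (v i))) := by
  change (∑ i : Fin k, η.toContinuousMultilinearMap.compContinuousLinearMap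
      (Function.update (fun _ => ContinuousLinearMap.id ℝ V) i A) :
      ContinuousMultilinearMap ℝ (fun _ : Fin k => V) ℝ) v = _
  rw [sum_apply]
  refine Finset.sum_congr rfl fun m _ => ?_
  change η _ = η _
  congr 1
  funext a
  by_cases h : a = m
  · subst h; simp
  · simp [h]

/-- Pull-back of a bilinear form by a linear map: `(A^* h)(v, w) = h(A v, A w)`. -/
def pullbackBilin {V' : Type*} [AddCommGroup V'] [Module ℝ V'] [TopologicalSpace V']
    [IsTopologicalAddGroup V] [ContinuousSMul ℝ V] [IsTopologicalAddGroup V'] [ContinuousSMul ℝ V']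
    (A : V' →L[ℝ] V) (h : V →L[ℝ] V →L[ℝ] ℝ) : V' →L[ℝ] V' →L[ℝ] ℝ :=
  (ContinuousLinearMap.precomp ℝ A).comp (h.comp A)

/-- The elementary `3`-form `eⁱ ∧ eʲ ∧ eᵏ` on `ℝ⁷`. -/
def e3 (i j k : Fin 7) : (Fin 7 → ℝ) [⋀^Fin 3]→ₗ[ℝ] ℝ :=
  (Matrix.detRowAlternating (R := ℝ) (n := Fin 3)).compLinearMap (LinearMap.funLeft ℝ ℝ ![i, j, k])

/-- The model form `e¹²³ + e¹⁴⁵ + e¹⁶⁷ + e²⁴⁶ - e²⁵⁷ - e³⁴⁷ - e³⁵⁶` on `ℝ⁷`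
(the indices below start from `0`). -/
def phi0 : (Fin 7 → ℝ) [⋀^Fin 3]→ₗ[ℝ] ℝ :=
  e3 0 1 2 + e3 0 3 4 + e3 0 5 6 + e3 1 3 5 - e3 1 4 6 - e3 2 3 6 - e3 2 4 5

/-- A `3`-form on `V` is positive if it is the pull-back of the model form by a linear
isomorphism `V ≃ ℝ⁷`. -/
def IsPositive (φ : V [⋀^Fin 3]→L[ℝ] ℝ) : Prop :=
  ∃ u : V ≃ₗ[ℝ] (Fin 7 → ℝ), ∀ v : Fin 3 → V, φ v = phi0 (fun a => u (v a))

/-- The value on `w₁, …, w₇` of the `7`-form `B_φ(u, v) = ⅙ (u ⌟ φ) ∧ (v ⌟ φ) ∧ φ`. The wedge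
product of a `2`-form, a `2`-form and a `3`-form is the antisymmetrised product divided by
`2! 2! 3!`. -/
def B (φ : V [⋀^Fin 3]→L[ℝ] ℝ) (u v : V) (w : Fin 7 → V) : ℝ :=
  (1 / 6) * ((1 / (2 * 2 * 6)) * ∑ σ : Equiv.Perm (Fin 7), ((Equiv.Perm.sign σ : ℤ) : ℝ) *
    (contract u φ ![w (σ 0), w (σ 1)] * contract v φ ![w (σ 2), w (σ 3)] *
      φ ![w (σ 4), w (σ 5), w (σ 6)]))

/-- The matrix of `B_φ` in a basis `b`, with `Λ⁷V^*` identified with `ℝ` by evaluation on `b`. -/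
def Bmat (b : Module.Basis (Fin 7) ℝ V) (φ : V [⋀^Fin 3]→L[ℝ] ℝ) : Matrix (Fin 7) (Fin 7) ℝ :=
  Matrix.of fun i j => B φ (b i) (b j) b

/-- The real ninth root. -/
def root9 (t : ℝ) : ℝ := (SignType.sign t : ℝ) * |t| ^ (1 / 9 : ℝ)

/-- The number `c` with `vol_g = c b¹ ∧ ⋯ ∧ b⁷`. The relation `g(u, v) vol_g = B_φ(u, v)` reads
`c g_{ij} = B_{ij}`; as `c² = det g`, it gives `c⁹ = det B`. -/
def volCoeff (b : Module.Basis (Fin 7) ℝ V) (φ : V [⋀^Fin 3]→L[ℝ] ℝ) : ℝ :=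
  root9 (Bmat b φ).det

/-- The matrix `g_{ij}` of the metric of `φ` in the basis `b`,
determined by `g(u, v) vol_g = B_φ(u, v)`. -/
def gram (b : Module.Basis (Fin 7) ℝ V) (φ : V [⋀^Fin 3]→L[ℝ] ℝ) : Matrix (Fin 7) (Fin 7) ℝ :=
  (volCoeff b φ)⁻¹ • Bmat b φ

/-- The inverse matrix `g^{ij}`. -/
def gramInv (b : Module.Basis (Fin 7) ℝ V) (φ : V [⋀^Fin 3]→L[ℝ] ℝ) : Matrix (Fin 7) (Fin 7) ℝ :=
  (gram b φ)⁻¹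

variable [IsTopologicalAddGroup V] [ContinuousSMul ℝ V] [T2Space V]

/-- The coordinate functional `bⁱ` of a basis, as a continuous linear map. -/
def coordL (b : Module.Basis (Fin 7) ℝ V) (i : Fin 7) : V →L[ℝ] ℝ :=
  { b.coord i with
    cont := by
      have : FiniteDimensional ℝ V := Module.Finite.of_basis b
      exact LinearMap.continuous_of_finiteDimensional (b.coord i) }

/-- The metric of `φ`, `g = g_{ij} bⁱ ⊗ bʲ`. -/
def metric (b : Module.Basis (Fin 7) ℝ V) (φ : V [⋀^Fin 3]→L[ℝ] ℝ) : V →L[ℝ] V →L[ℝ] ℝ :=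
  ∑ i, ∑ j, gram b φ i j • (coordL b i).smulRight (coordL b j)

/-- The volume form of the metric and orientation of `φ`. -/
def vol (b : Module.Basis (Fin 7) ℝ V) (φ : V [⋀^Fin 3]→L[ℝ] ℝ) : V [⋀^Fin 7]→L[ℝ] ℝ :=
  volCoeff b φ •
    { b.det with
      cont := by
        have h : Continuous fun v : Fin 7 → V =>
            (Matrix.of fun i j => coordL b i (v j) : Matrix (Fin 7) (Fin 7) ℝ).det :=
          Continuous.matrix_det <| continuous_matrix fun i j =>
            (coordL b i).continuous.comp (continuous_apply j)
        refine h.congr fun v => ?_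
        change _ = b.det v
        rw [Module.Basis.det_apply]
        rfl }

/-- The Hodge star `Λ^p → Λ^q`, `p + q = 7`, of the metric and orientation of `φ`:
`(*α)_{j₁…j_q} = (1/p!) α^{i₁…i_p} vol_{i₁…i_p j₁…j_q}`, with indices raised by `g`. -/
def star (b : Module.Basis (Fin 7) ℝ V) (φ : V [⋀^Fin 3]→L[ℝ] ℝ) (p q : ℕ) (hpq : q + p = 7)
    (α : V [⋀^Fin p]→L[ℝ] ℝ) : V [⋀^Fin q]→L[ℝ] ℝ :=
  (1 / (p.factorial : ℝ)) • ∑ i : Fin p → Fin 7,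
    (∑ j : Fin p → Fin 7, (∏ a, gramInv b φ (i a) (j a)) * α (fun a => b (j a))) •
      insertVecs p (fun a => b (i a)) (hpq ▸ vol b φ)

/-- The `4`-form `ψ = *φ`. -/
def psi (b : Module.Basis (Fin 7) ℝ V) (φ : V [⋀^Fin 3]→L[ℝ] ℝ) : V [⋀^Fin 4]→L[ℝ] ℝ :=
  star b φ 3 4 rfl φ

/-- The vector `α^♯` with `α^♯ = g^{ij} α_j b_i`. -/
def sharp (b : Module.Basis (Fin 7) ℝ V) (φ : V [⋀^Fin 3]→L[ℝ] ℝ) (α : V [⋀^Fin 1]→L[ℝ] ℝ) : V :=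
  ∑ i, ∑ j, (gramInv b φ i j * α ![b j]) • b i

/-- The endomorphism `h_i^l = g^{lm} h_{mi}` of a symmetric bilinear form `h`. -/
def raise (b : Module.Basis (Fin 7) ℝ V) (φ : V [⋀^Fin 3]→L[ℝ] ℝ) (h : V →L[ℝ] V →L[ℝ] ℝ) :
    V →L[ℝ] V :=
  ∑ l, ∑ m, gramInv b φ l m • (h (b m)).smulRight (b l)

/-- The map `i_φ : S²V^* → Λ³V^*`,
`i_φ(h)_{ijk} = h_i^l φ_{ljk} - h_j^l φ_{lik} - h_k^l φ_{lji}
  = h_i^l φ_{ljk} + h_j^l φ_{ilk} + h_k^l φ_{ijl}`. -/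
def iPhi (b : Module.Basis (Fin 7) ℝ V) (φ : V [⋀^Fin 3]→L[ℝ] ℝ) (h : V →L[ℝ] V →L[ℝ] ℝ) :
    V [⋀^Fin 3]→L[ℝ] ℝ :=
  derivAction (raise b φ h) φ

end Linear

/-! ### Tensor fields on a `7`-manifold -/

section Manifold

/-- The model space `ℝ⁷`. -/
abbrev E7 : Type := EuclideanSpace ℝ (Fin 7)

variable {M : Type*} [TopologicalSpace M] [ChartedSpace E7 M]

instance (x : M) : T2Space (TangentSpace (𝓡 7) x) := inferInstanceAs (T2Space E7)

variable (M) in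
/-- Differential `k`-forms (no regularity required). -/
abbrev Form (k : ℕ) : Type _ := ∀ x : M, TangentSpace (𝓡 7) x [⋀^Fin k]→L[ℝ] ℝ

variable (M) in
/-- Covariant `2`-tensor fields (no regularity required). -/
abbrev Tensor2 : Type _ := ∀ x : M, TangentSpace (𝓡 7) x →L[ℝ] TangentSpace (𝓡 7) x →L[ℝ] ℝ

variable (M) in
/-- Vector fields (no regularity required). -/
abbrev VField : Type _ := ∀ x : M, TangentSpace (𝓡 7) x

/-- The coordinate basis of `T_x M` given by the preferred chart at `x`; in Mathlib `T_x M` is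
a copy of the model space through this chart. -/
def tangentBasis (x : M) : Module.Basis (Fin 7) ℝ (TangentSpace (𝓡 7) x) :=
  (EuclideanSpace.basisFun (Fin 7) ℝ).toBasis

/-- The inverse of the preferred chart at `x₀`, as a map from `ℝ⁷`
(relevant on the target of the chart only). -/
abbrev chartInv (x₀ : M) : E7 → M := (extChartAt (𝓡 7) x₀).symm

/-- A form read in the preferred chart at `x₀`. -/
def Form.inChart {k : ℕ} (η : Form M k) (x₀ : M) (y : E7) : E7 [⋀^Fin k]→L[ℝ] ℝ :=
  (η (chartInv x₀ y)).compContinuousLinearMap (mfderiv 𝓘(ℝ, E7) (𝓡 7) (chartInv x₀) y)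

/-- A covariant `2`-tensor field read in the preferred chart at `x₀`. -/
def Tensor2.inChart (h : Tensor2 M) (x₀ : M) (y : E7) : E7 →L[ℝ] E7 →L[ℝ] ℝ :=
  pullbackBilin (V := TangentSpace (𝓡 7) (chartInv x₀ y))
    (mfderiv 𝓘(ℝ, E7) (𝓡 7) (chartInv x₀) y) (h (chartInv x₀ y))

/-- A vector field read in the preferred chart at `x₀`. -/
def VField.inChart (X : VField M) (x₀ : M) (y : E7) : E7 :=
  VectorField.mpullback 𝓘(ℝ, E7) (𝓡 7) (chartInv x₀) X y

/-- Smoothness of a form: it is smooth in all preferred charts. -/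
def Form.IsSmooth {k : ℕ} (η : Form M k) : Prop :=
  ∀ x₀ : M, ContDiffOn ℝ ∞ (η.inChart x₀) (extChartAt (𝓡 7) x₀).target

/-- Smoothness of a vector field, as a section of the tangent bundle. -/
def VField.IsSmooth [IsManifold (𝓡 7) 1 M] (X : VField M) : Prop :=
  ContMDiff (𝓡 7) (𝓡 7).tangent ∞ (fun x => (⟨x, X x⟩ : TangentBundle (𝓡 7) M))

/-- The exterior derivative, computed at `x` in the preferred chart at `x`. -/
def Form.d {k : ℕ} (η : Form M k) : Form M (k + 1) := fun x =>
  (extDeriv (η.inChart x) (extChartAt (𝓡 7) x x)).compContinuousLinearMap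
    (mfderiv (𝓡 7) 𝓘(ℝ, E7) (extChartAt (𝓡 7) x) x)

/-- The Lie derivative of a form, computed at `x` in the preferred chart at `x`:
`(L_X η)(v₁, …, v_k) = (D_X η)(v₁, …, v_k) + ∑ᵢ η(v₁, …, D_{vᵢ} X, …, v_k)`. -/
def Form.lie {k : ℕ} (X : VField M) (η : Form M k) : Form M k := fun x =>
  (fderiv ℝ (η.inChart x) (extChartAt (𝓡 7) x x) (X.inChart x (extChartAt (𝓡 7) x x)) +
    derivAction (fderiv ℝ (X.inChart x) (extChartAt (𝓡 7) x x))
      (η.inChart x (extChartAt (𝓡 7) x x))).compContinuousLinearMap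
    (mfderiv (𝓡 7) 𝓘(ℝ, E7) (extChartAt (𝓡 7) x) x)

/-- The Lie derivative of a covariant `2`-tensor field, computed at `x` in the preferred chart
at `x`: `(L_X h)(v, w) = (D_X h)(v, w) + h(D_v X, w) + h(v, D_w X)`. -/
def Tensor2.lie (X : VField M) (h : Tensor2 M) : Tensor2 M := fun x =>
  pullbackBilin (V := E7) (V' := TangentSpace (𝓡 7) x)
    (mfderiv (𝓡 7) 𝓘(ℝ, E7) (extChartAt (𝓡 7) x) x)
    (fderiv ℝ (h.inChart x) (extChartAt (𝓡 7) x x) (X.inChart x (extChartAt (𝓡 7) x x)) +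
      (h.inChart x (extChartAt (𝓡 7) x x)).bilinearComp
        (fderiv ℝ (X.inChart x) (extChartAt (𝓡 7) x x)) (ContinuousLinearMap.id ℝ E7) +
      (h.inChart x (extChartAt (𝓡 7) x x)).bilinearComp
        (ContinuousLinearMap.id ℝ E7) (fderiv ℝ (X.inChart x) (extChartAt (𝓡 7) x x)))

/-- The interior product `X ⌟ η` of a vector field and a form. -/
def Form.contract {k : ℕ} (X : VField M) (η : Form M (k + 1)) : Form M k :=
  fun x => G2.contract (X x) (η x)

/-- A `G₂` structure: a smooth `3`-form that is positive at every point. -/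
structure IsG2Structure (φ : Form M 3) : Prop where
  smooth : φ.IsSmooth
  positive : ∀ x, IsPositive (φ x)

/-- The Riemannian metric associated with `φ`. -/
def assocMetric (φ : Form M 3) : Tensor2 M := fun x => metric (tangentBasis x) (φ x)

/-- The Hodge star of the metric and orientation associated with `φ`. -/
def hodge (φ : Form M 3) (p q : ℕ) (hpq : q + p = 7) (α : Form M p) : Form M q :=
  fun x => star (tangentBasis x) (φ x) p q hpq (α x)

/-- The codifferential `d^* = * d *` of the associated metric on `2`-forms
(in dimension `7` the sign `(-1)^{n(p+1)+1}` is `+1` for `p = 2`). -/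
def codiff (φ : Form M 3) (β : Form M 2) : Form M 1 :=
  hodge φ 6 1 rfl (hodge φ 2 5 rfl β).d

/-- The `4`-form `ψ = *φ`. -/
def psiForm (φ : Form M 3) : Form M 4 := hodge φ 3 4 rfl φ

/-- The vector field `α^♯` of a `1`-form `α`. -/
def sharpField (φ : Form M 3) (α : Form M 1) : VField M :=
  fun x => sharp (tangentBasis x) (φ x) (α x)

/-- The `3`-form `i_φ(h)` of a symmetric `2`-tensor field `h`. -/
def iPhiForm (φ : Form M 3) (h : Tensor2 M) : Form M 3 :=
  fun x => iPhi (tangentBasis x) (φ x) (h x)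

/-- `X` is a symmetry of `φ`: `L_X φ = 0`. -/
def IsSymmetry (φ : Form M 3) (X : VField M) : Prop := Form.lie X φ = 0

/-- `X` is a Killing field of `g`: `L_X g = 0`. -/
def IsKilling (g : Tensor2 M) (X : VField M) : Prop := Tensor2.lie X g = 0

end Manifold

end G2

end

namespace G2

/-! ### The structure constants of the model form -/

/-! The argument is pointwise and rests on the action of `GL(7)` on positive forms. The orbit of a
positive form is open. Infinitesimally, every `3`-form at a point is `A · φ` for some endomorphism
`A` (`IsAdapted.exists_derivAction_eq`), and in particular `L_X φ = A · φ`. It remains to read off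
the parts of `A` that matter from geometric data.

Symmetric part. The metric is an equivariant function of the form, so its derivative along `A · φ`
is `g(A u, v) + g(u, A v)` (`IsAdapted.fderiv_metric_derivAction`). By the chain rule `L_X g` is the
image of `L_X φ` under this derivative (`flatLie_metric`). Hence `½ i_φ(L_X g)` is the action on `φ`
of the symmetric part of `A`.

Skew part. As a `G₂` representation `so(7) = g₂ ⊕ ℝ⁷`, and `g₂` kills `φ`. The action of a skew
endomorphism is therefore `v ⌟ ψ` up to scale, with `v` its `ℝ⁷` component, and `v` is recovered
from `θ = ½ *((A · φ) ∧ φ)`, to which symmetric endomorphisms do not contribute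
(`IsAdapted.derivAction_eq`). Finally `θ = d^*(X ⌟ φ)`: since `*(X ⌟ φ) = ½ (X ⌟ φ) ∧ φ` and `dφ =
0`, Cartan's formula gives `d*(X ⌟ φ) = ½ d(X ⌟ φ) ∧ φ = ½ (L_X φ) ∧ φ` (`extDeriv_star_contract`).

Both `L_X g` and `d^*(X ⌟ φ)` are thus obtained linearly from `L_X φ`, so they vanish with it. The
converse is immediate from the formula.

The algebraic identities are checked on integer structure constants in an adapted basis, which is
orthonormal and oriented. Naturality under linear isomorphisms makes the metric operations
independent of the auxiliary basis, and so transfers everything to a chart. -/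

/-- `r` multiplied by the sign of `b - a`. -/
def signMul (a b : Fin 7) (r : ℤ) : ℤ :=
  bif a.val.blt b.val then r else bif b.val.blt a.val then -r else 0

/-- The Levi-Civita symbol in seven indices. -/
def leviCivita (a b c d e f g : Fin 7) : ℤ :=
  signMul a b <| signMul a c <| signMul b c <|
  signMul a d <| signMul b d <| signMul c d <|
  signMul a e <| signMul b e <| signMul c e <| signMul d e <|
  signMul a f <| signMul b f <| signMul c f <| signMul d f <| signMul e f <|
  signMul a g <| signMul b g <| signMul c g <| signMul d g <| signMul e g <| signMul f g 1

/-- The components of the model `3`-form: with labels `1, …, 7`, the triples that occur are those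
with vanishing exclusive or. -/
def eps (i j k : Fin 7) : ℤ :=
  bif ((i.val + 1) ^^^ (j.val + 1)).beq (k.val + 1) then
    signMul i j <| signMul i k <| signMul j k <|
      -- The product is `0` for the triples through index `0` and `15` for `{1, 3, 5}`. These are
      -- exactly the four positive terms of the model form.
      bif (i.val * j.val * k.val).beq 0 || (i.val * j.val * k.val).beq 15 then 1 else -1
  else 0

/-- The components of the model `4`-form. -/
def epsDual (i j k l : Fin 7) : ℤ :=
  bif ((i.val + 1) ^^^ (j.val + 1) ^^^ (k.val + 1)).beq (l.val + 1) then
    signMul i j <| signMul i k <| signMul i l <| signMul j k <| signMul j l <| signMul k l <|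
      -- Each quadruple has the sign of its complementary triple: those avoiding index `0` and `{0,
      -- 2, 4, 6}`, of sum `12`, are positive.
      bif !((i.val * j.val * k.val * l.val).beq 0) || (i.val + j.val + k.val + l.val).beq 12
        then 1 else -1
  else 0

/-- The components of the elementary `3`-form `eᵃ ∧ eᵇ ∧ eᶜ`. -/
def delta3 (a b c i j k : Fin 7) : ℤ :=
  let δ (x y : Fin 7) : ℤ := bif x.val.beq y.val then 1 else 0
  δ a i * (δ b j * δ c k - δ b k * δ c j) - δ a j * (δ b i * δ c k - δ b k * δ c i)
    + δ a k * (δ b i * δ c j - δ b j * δ c i)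

theorem eps_eq_sum_delta3 : ∀ i j k : Fin 7, eps i j k =
    delta3 0 1 2 i j k + delta3 0 3 4 i j k + delta3 0 5 6 i j k + delta3 1 3 5 i j k
      - delta3 1 4 6 i j k - delta3 2 3 6 i j k - delta3 2 4 5 i j k := by
  decide +kernel

/-- The index completing `i` and `j` to a triple on which `eps` does not vanish. -/
def third (i j : Fin 7) : Fin 7 :=
  Fin.ofNat 7 (((i.val + 1) ^^^ (j.val + 1)) - 1)

/-- The labels `1, …, 7` are the nonzero vectors of `𝔽₂³` and the triples are the lines of the Fano
plane, so two points determine the third. For `i = j` truncated subtraction makes `third` equal to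
`0`, which is harmless as `eps` vanishes there. -/
theorem eps_eq_zero_of_ne_third : ∀ i j k : Fin 7, k ≠ third i j → eps i j k = 0 := by
  decide +kernel

/-- `r` multiplied by `s`, where `r` is not evaluated if `s = 0`. -/
def lazyMul (s r : ℤ) : ℤ := bif decide (s = 0) then 0 else s * r

theorem lazyMul_eq (s r : ℤ) : lazyMul s r = s * r := by
  by_cases h : s = 0 <;> simp [lazyMul, h]

/-- The sum of `eps i a b * F a b` over `a` and `b`. -/
def epsSum (i : Fin 7) (F : Fin 7 → Fin 7 → ℤ) : ℤ :=
  ∑ a, lazyMul (eps i a (third i a)) (F a (third i a))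

theorem sum_eps_mul (i : Fin 7) (F : Fin 7 → Fin 7 → ℤ) :
    ∑ a, ∑ b, eps i a b * F a b = epsSum i F := by
  refine Finset.sum_congr rfl fun a _ => ?_
  rw [Finset.sum_eq_single (third i a), lazyMul_eq]
  · intro b _ hb
    rw [eps_eq_zero_of_ne_third i a b hb, zero_mul]
  · simp

/-- The sign of `b - a`. -/
def signDiff (a b : Fin 7) : ℤ := signMul a b 1

theorem signMul_eq (a b : Fin 7) (r : ℤ) : signMul a b r = signDiff a b * r := by
  unfold signDiff signMul
  cases a.val.blt b.val <;> cases b.val.blt a.val <;> simp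

theorem signDiff_self (a : Fin 7) : signDiff a a = 0 := by
  revert a; decide

theorem signDiff_of_ne {a b : Fin 7} (h : a ≠ b) : signDiff a b = if a < b then 1 else -1 := by
  revert a b; decide

theorem leviCivita_eq_prod (f : Fin 7 → Fin 7) :
    leviCivita (f 0) (f 1) (f 2) (f 3) (f 4) (f 5) (f 6) =
      ∏ i, ∏ j ∈ Finset.Ioi i, signDiff (f i) (f j) := by
  have h0 : Finset.Ioi (0 : Fin 7) = {1, 2, 3, 4, 5, 6} := by decide
  have h1 : Finset.Ioi (1 : Fin 7) = {2, 3, 4, 5, 6} := by decide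
  have h2 : Finset.Ioi (2 : Fin 7) = {3, 4, 5, 6} := by decide
  have h3 : Finset.Ioi (3 : Fin 7) = {4, 5, 6} := by decide
  have h4 : Finset.Ioi (4 : Fin 7) = {5, 6} := by decide
  have h5 : Finset.Ioi (5 : Fin 7) = {6} := by decide
  have h6 : Finset.Ioi (6 : Fin 7) = ∅ := by decide
  rw [Fin.prod_univ_seven, h0, h1, h2, h3, h4, h5, h6]
  simp only [leviCivita, signMul_eq]
  repeat rw [Finset.prod_insert (by decide)]
  simp only [Finset.prod_singleton, Finset.prod_empty]
  ring

theorem leviCivita_perm (σ : Equiv.Perm (Fin 7)) :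
    leviCivita (σ 0) (σ 1) (σ 2) (σ 3) (σ 4) (σ 5) (σ 6) = Equiv.Perm.sign σ := by
  rw [leviCivita_eq_prod, σ.sign_eq_prod_prod_Ioi, Units.coe_prod]
  refine Finset.prod_congr rfl fun i _ => ?_
  rw [Units.coe_prod]
  refine Finset.prod_congr rfl fun j hj => ?_
  rw [signDiff_of_ne (σ.injective.ne (Finset.mem_Ioi.1 hj).ne)]
  split_ifs <;> rfl

theorem leviCivita_of_not_injective (f : Fin 7 → Fin 7) (hf : ¬ Function.Injective f) :
    leviCivita (f 0) (f 1) (f 2) (f 3) (f 4) (f 5) (f 6) = 0 := by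
  rw [leviCivita_eq_prod]
  obtain ⟨i, j, hij, hne⟩ : ∃ i j, f i = f j ∧ i < j := by
    simp only [Function.Injective, not_forall] at hf
    obtain ⟨i, j, h, hne⟩ := hf
    rcases lt_or_gt_of_ne hne with h' | h'
    · exact ⟨i, j, h, h'⟩
    · exact ⟨j, i, h.symm, h'⟩
  refine Finset.prod_eq_zero (Finset.mem_univ i) ?_
  exact Finset.prod_eq_zero (Finset.mem_Ioi.2 hne) (by rw [hij, signDiff_self])

/-- A signed sum over permutations is a sum over all tuples, weighted by the Levi-Civita symbol. -/
theorem sum_sign_mul_perm (F : (Fin 7 → Fin 7) → ℤ) :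
    ∑ σ : Equiv.Perm (Fin 7), (Equiv.Perm.sign σ : ℤ) * F σ =
      ∑ f : Fin 7 → Fin 7, leviCivita (f 0) (f 1) (f 2) (f 3) (f 4) (f 5) (f 6) * F f := by
  refine Finset.sum_of_injOn (fun σ => ⇑σ) (fun σ _ τ _ h => DFunLike.coe_injective h)
    (by simp) ?_ ?_
  · intro f _ hf
    rw [leviCivita_of_not_injective, zero_mul]
    intro h
    exact hf ⟨Equiv.ofBijective f (Finite.injective_iff_bijective.1 h), by simp, rfl⟩
  · intro σ _
    rw [leviCivita_perm]

theorem sum_fin_succ_fun {M : Type*} [AddCommMonoid M] {n : ℕ} {κ : Type*} [Fintype κ]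
    (F : (Fin (n + 1) → κ) → M) :
    ∑ f, F f = ∑ a, ∑ f : Fin n → κ, F (Matrix.vecCons a f) := by
  rw [← (Fin.consEquiv fun _ : Fin (n + 1) => κ).sum_comp, Fintype.sum_prod_type]
  rfl

theorem sum_fin_zero_fun {M : Type*} [AddCommMonoid M] {κ : Type*} [Fintype κ]
    (F : (Fin 0 → κ) → M) : ∑ f, F f = F ![] := by
  rw [Fintype.sum_unique]
  congr 1

/-- The part of the Levi-Civita symbol that involves only the first four indices. -/
def leviCivitaHead (a b c d : Fin 7) : ℤ :=
  signMul a b <| signMul a c <| signMul b c <| signMul a d <| signMul b d <| signMul c d 1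

/-- The part of the Levi-Civita symbol comparing the fifth index with the first four. -/
def leviCivitaMid (a b c d e : Fin 7) : ℤ :=
  signMul a e <| signMul b e <| signMul c e <| signMul d e 1

/-- The part of the Levi-Civita symbol that involves the last two indices. -/
def leviCivitaTail (a b c d e f g : Fin 7) : ℤ :=
  signMul a f <| signMul b f <| signMul c f <| signMul d f <| signMul e f <|
  signMul a g <| signMul b g <| signMul c g <| signMul d g <| signMul e g <| signMul f g 1

/-- Splitting the symbol lets the nested sums below discard a branch as soon as the early indices
repeat, which keeps the kernel evaluation small. -/
theorem leviCivita_eq_mul (a b c d e f g : Fin 7) : leviCivita a b c d e f g =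
    leviCivitaHead a b c d * (leviCivitaMid a b c d e * leviCivitaTail a b c d e f g) := by
  simp only [leviCivita, leviCivitaHead, leviCivitaMid, leviCivitaTail, signMul_eq]
  ring

theorem epsSum_epsSum_leviCivita_aux : ∀ i j : Fin 7,
    epsSum i (fun a b => epsSum j fun c d => lazyMul (leviCivitaHead a b c d) <|
      ∑ e, lazyMul (leviCivitaMid a b c d e) (epsSum e fun f g => leviCivitaTail a b c d e f g)) =
    if i = j then 144 else 0 := by
  decide +kernel

/-- This is the defining relation of the metric for the model form. The constant is `144 = 6 · 2! 2!
3!`, the inverse of the normalisation in `B`. -/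
theorem sum_sign_mul_eps (i j : Fin 7) :
    ∑ σ : Equiv.Perm (Fin 7), (Equiv.Perm.sign σ : ℤ) *
      (eps i (σ 0) (σ 1) * eps j (σ 2) (σ 3) * eps (σ 4) (σ 5) (σ 6)) =
    if i = j then 144 else 0 := by
  rw [sum_sign_mul_perm fun f => eps i (f 0) (f 1) * eps j (f 2) (f 3) * eps (f 4) (f 5) (f 6),
    ← epsSum_epsSum_leviCivita_aux]
  simp only [sum_fin_succ_fun, sum_fin_zero_fun, ← sum_eps_mul, lazyMul_eq, leviCivita_eq_mul,
    Finset.mul_sum]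
  refine Finset.sum_congr rfl fun a _ => Finset.sum_congr rfl fun b _ =>
    Finset.sum_congr rfl fun c _ => Finset.sum_congr rfl fun d _ =>
    Finset.sum_congr rfl fun e _ => Finset.sum_congr rfl fun f _ =>
    Finset.sum_congr rfl fun g _ => ?_
  change leviCivitaHead a b c d * (leviCivitaMid a b c d e * leviCivitaTail a b c d e f g) *
    (eps i a b * eps j c d * eps e f g) = _
  ring

end G2

namespace G2

/-! ### Wedge products as shuffle sums, and identities between the structure constants. -/

section Shuffle

variable {ι R : Type*} [CommRing R]

/-- The wedge product of a `2`-form and a `3`-form as a sum over shuffles. -/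
def shuffle23 (α : ι → ι → R) (β : ι → ι → ι → R) (a b c d e : ι) : R :=
  α a b * β c d e - α a c * β b d e + α a d * β b c e - α a e * β b c d + α b c * β a d e
    - α b d * β a c e + α b e * β a c d + α c d * β a b e - α c e * β a b d + α d e * β a b c

/-- The wedge product of two `3`-forms as a sum over shuffles. -/
def shuffle33 (α β : ι → ι → ι → R) (a b c d e f : ι) : R :=
  α a b c * β d e f - α a b d * β c e f + α a b e * β c d f - α a b f * β c d e
    + α a c d * β b e f - α a c e * β b d f + α a c f * β b d e + α a d e * β b c f
    - α a d f * β b c e + α a e f * β b c d - α b c d * β a e f + α b c e * β a d f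
    - α b c f * β a d e - α b d e * β a c f + α b d f * β a c e - α b e f * β a c d
    + α c d e * β a b f - α c d f * β a b e + α c e f * β a b d - α d e f * β a b c

end Shuffle

/-- Component form of `*(eᵢ ⌟ φ) = ½ (eᵢ ⌟ φ) ∧ φ`; the left side is the star without its factor
`1/2!`. Both sides are alternating, so increasing indices suffice. -/
theorem epsSum_leviCivita_eq_shuffle23 : ∀ i a b : Fin 7, a < b → ∀ c, b < c → ∀ d, c < d →
    ∀ e, d < e → epsSum i (fun p q => leviCivita p q a b c d e) =
      shuffle23 (eps i) eps a b c d e := by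
  decide +kernel

/-- Component form of `*φ = ψ`, where `6 = 3!` is the factor omitted from the star. -/
theorem sum_epsSum_leviCivita_eq_epsDual : ∀ a b c : Fin 7, b < c → ∀ d, c < d →
    ∑ p, epsSum p (fun q r => leviCivita p q r a b c d) = 6 * epsDual a b c d := by
  decide +kernel

/-- The components of the derivation action of the elementary endomorphism `e_q ↦ e_p` on the
model form. -/
def epsAction (p q i j k : Fin 7) : ℤ :=
  (bif q.val.beq i.val then eps p j k else 0) + (bif q.val.beq j.val then eps i p k else 0) +
    (bif q.val.beq k.val then eps i j p else 0)

/-- Computes `*((A · φ) ∧ φ)` for an elementary `A`: the `l.succAbove` indices run over the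
complement of `l`. The answer is skew in `p, q`, so symmetric endomorphisms do not contribute. -/
theorem shuffle33_epsAction : ∀ l p q : Fin 7,
    (-1) ^ l.val * shuffle33 (epsAction p q) eps (l.succAbove 0) (l.succAbove 1)
      (l.succAbove 2) (l.succAbove 3) (l.succAbove 4) (l.succAbove 5) = -2 * eps l p q := by
  decide +kernel

/-- A skew endomorphism acts on `φ` through its `ℝ⁷` component only, by contraction with `ψ`. -/
theorem epsAction_sub_epsAction_swap : ∀ i j k : Fin 7, i < j → j < k → ∀ p q : Fin 7,
    epsAction p q i j k - epsAction q p i j k =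
      -∑ l, eps l p q * epsDual l i j k := by
  decide +kernel

/-- Components of six times an endomorphism whose action on the model form is
`eᵖ ∧ e^q ∧ eʳ`. -/
def epsInv (p q r l i : Fin 7) : ℤ :=
  let m (a b : Fin 7) : ℤ := (bif p.val.beq a.val then eps b q r else 0) +
    (bif q.val.beq a.val then eps b r p else 0) + (bif r.val.beq a.val then eps b p q else 0)
  m l i + 2 * m i l - (bif l.val.beq i.val then eps p q r else 0)

/-- An explicit right inverse of `A ↦ A · φ`. In `epsInv`, `m` is the contraction of `eᵖ ∧ e^q ∧ eʳ`
with `φ` in two indices. The coefficients of `m`, its transpose and the trace term give the right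
scale on each summand of `Λ³ = 1 ⊕ 7 ⊕ 27`. -/
theorem epsInv_action : ∀ p q : Fin 7, p < q → ∀ r, q < r → ∀ i j : Fin 7, i < j → ∀ k, j < k →
    ∑ l, (lazyMul (eps l j k) (epsInv p q r l i) + lazyMul (eps i l k) (epsInv p q r l j) +
      lazyMul (eps i j l) (epsInv p q r l k)) =
    if p = i ∧ q = j ∧ r = k then 6 else 0 := by
  decide +kernel

end G2

noncomputable section

namespace G2

/-! ### Adapted bases -/

section Adapted

open Module

variable {V : Type*} [AddCommGroup V] [Module ℝ V]

theorem basis_det_comp (e : Basis (Fin 7) ℝ V) (f : Fin 7 → Fin 7) :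
    e.det (fun i => e (f i)) =
      (leviCivita (f 0) (f 1) (f 2) (f 3) (f 4) (f 5) (f 6) : ℤ) := by
  by_cases hf : Function.Injective f
  · obtain ⟨σ, rfl⟩ : ∃ σ : Equiv.Perm (Fin 7), ⇑σ = f :=
      ⟨Equiv.ofBijective f (Finite.injective_iff_bijective.1 hf), rfl⟩
    rw [leviCivita_perm]
    have := e.det.map_perm e σ
    rw [e.det_self] at this
    refine this.trans ?_
    rw [Units.smul_def, zsmul_one]
  · rw [leviCivita_of_not_injective f hf, Int.cast_zero]
    simp only [Function.Injective, not_forall] at hf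
    obtain ⟨i, j, h, hne⟩ := hf
    exact e.det.map_eq_zero_of_eq _ (by rw [h]) hne

theorem basis_det_vec (e : Basis (Fin 7) ℝ V) (a b c d f g h : Fin 7) :
    e.det ![e a, e b, e c, e d, e f, e g, e h] = (leviCivita a b c d f g h : ℤ) := by
  refine Eq.trans ?_ (basis_det_comp e ![a, b, c, d, f, g, h])
  congr 1
  ext i
  fin_cases i <;> rfl

variable [TopologicalSpace V]

/-- A `3`-form as a trilinear map. -/
def triLin (φ : V [⋀^Fin 3]→L[ℝ] ℝ) : V →ₗ[ℝ] V →ₗ[ℝ] V →ₗ[ℝ] ℝ :=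
  have u0 (a b c x : V) : Function.update ![a, b, c] 0 x = ![x, b, c] := by
    ext i; fin_cases i <;> rfl
  have u1 (a b c x : V) : Function.update ![a, b, c] 1 x = ![a, x, c] := by
    ext i; fin_cases i <;> rfl
  have u2 (a b c x : V) : Function.update ![a, b, c] 2 x = ![a, b, x] := by
    ext i; fin_cases i <;> rfl
  { toFun := fun a => LinearMap.mk₂ ℝ (fun b c => φ ![a, b, c])
      (fun x y c => by simpa only [u1] using φ.map_update_add ![a, x, c] 1 x y)
      (fun r x c => by simpa only [u1] using φ.map_update_smul ![a, x, c] 1 r x)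
      (fun b x y => by simpa only [u2] using φ.map_update_add ![a, b, x] 2 x y)
      (fun r b x => by simpa only [u2] using φ.map_update_smul ![a, b, x] 2 r x)
    map_add' := fun x y => by
      ext b c
      have := φ.map_update_add ![x, b, c] 0 x y
      simp only [u0] at this
      exact this
    map_smul' := fun r x => by
      ext b c
      have := φ.map_update_smul ![x, b, c] 0 r x
      simp only [u0] at this
      exact this }

theorem triLin_apply (φ : V [⋀^Fin 3]→L[ℝ] ℝ) (a b c : V) : triLin φ a b c = φ ![a, b, c] := rfl

theorem contract_apply {n : ℕ} (v : V) (η : V [⋀^Fin (n + 1)]→L[ℝ] ℝ) (w : Fin n → V) :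
    contract v η w = η (Matrix.vecCons v w) := rfl

/-- A basis in which the components of `φ` are those of the model form. -/
def IsAdapted (e : Basis (Fin 7) ℝ V) (φ : V [⋀^Fin 3]→L[ℝ] ℝ) : Prop :=
  ∀ i j k, φ ![e i, e j, e k] = eps i j k

theorem e3_single (a b c i j k : Fin 7) :
    e3 a b c ![Pi.single i 1, Pi.single j 1, Pi.single k 1] = delta3 a b c i j k := by
  change Matrix.det (Matrix.of fun x => (LinearMap.funLeft ℝ ℝ ![a, b, c])
    ((![Pi.single i 1, Pi.single j 1, Pi.single k 1] : Fin 3 → Fin 7 → ℝ) x)) = _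
  have h (x y : Fin 7) : (Pi.single x (1 : ℝ) : Fin 7 → ℝ) y =
      ((bif y.val.beq x.val then 1 else 0 : ℤ) : ℝ) := by
    rw [Pi.single_apply]
    by_cases hxy : y = x
    · subst hxy; simp
    · have : y.val.beq x.val = false := by
        rw [← Bool.not_eq_true, Nat.beq_eq]
        exact fun h' => hxy (Fin.ext h')
      simp [hxy, this]
  rw [Matrix.det_fin_three]
  simp only [Matrix.of_apply, LinearMap.funLeft_apply, Matrix.cons_val_zero, Matrix.cons_val_one,
    Matrix.cons_val, h, delta3]
  push_cast
  ring

theorem exists_isAdapted {φ : V [⋀^Fin 3]→L[ℝ] ℝ} (h : IsPositive φ) :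
    ∃ e : Basis (Fin 7) ℝ V, IsAdapted e φ := by
  obtain ⟨u, hu⟩ := h
  refine ⟨(Pi.basisFun ℝ (Fin 7)).map u.symm, fun i j k => ?_⟩
  rw [hu]
  have : (fun a => u (![(Pi.basisFun ℝ (Fin 7)).map u.symm i, (Pi.basisFun ℝ (Fin 7)).map u.symm j,
      (Pi.basisFun ℝ (Fin 7)).map u.symm k] a)) =
      ![Pi.single i 1, Pi.single j 1, Pi.single k 1] := by
    funext a
    fin_cases a <;> simp
  rw [this, phi0, eps_eq_sum_delta3]
  simp only [AlternatingMap.add_apply, AlternatingMap.sub_apply, e3_single]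
  push_cast
  ring

/-- The product of `2`-, `2`- and `3`-forms that is antisymmetrised in the definition of `B`. -/
def prodMultilinear (φ : V [⋀^Fin 3]→L[ℝ] ℝ) (u v : V) :
    MultilinearMap ℝ (fun _ : Fin 7 => V) ℝ where
  toFun w := triLin φ u (w 0) (w 1) * triLin φ v (w 2) (w 3) * triLin φ (w 4) (w 5) (w 6)
  map_update_add' := by
    intro inst w i x y
    obtain rfl : inst = instDecidableEqFin 7 := Subsingleton.elim _ _
    fin_cases i <;> simp [Function.update] <;> ring
  map_update_smul' := by
    intro inst w i c x
    obtain rfl : inst = instDecidableEqFin 7 := Subsingleton.elim _ _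
    fin_cases i <;> simp [Function.update] <;> ring

/-- Exhibits the signed sum as an alternating form of top degree, hence a multiple of a determinant.
-/
theorem B_eq_alternatization (φ : V [⋀^Fin 3]→L[ℝ] ℝ) (u v : V) (w : Fin 7 → V) :
    B φ u v w = (1 / 144) * MultilinearMap.alternatization (prodMultilinear φ u v) w := by
  rw [B, MultilinearMap.alternatization_apply, ← mul_assoc]
  congr 1
  · norm_num
  · refine Finset.sum_congr rfl fun σ _ => ?_
    rw [Units.smul_def, zsmul_eq_mul]
    rfl

theorem B_eq_mul_det (e : Basis (Fin 7) ℝ V) (φ : V [⋀^Fin 3]→L[ℝ] ℝ) (u v : V)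
    (w : Fin 7 → V) : B φ u v w = B φ u v e * e.det w := by
  have key (F : V [⋀^Fin 7]→ₗ[ℝ] ℝ) : F w = F e * e.det w := by
    conv_lhs => rw [F.eq_smul_basis_det e]
    rfl
  rw [B_eq_alternatization, B_eq_alternatization, mul_assoc, key]

/-- This is what makes an adapted basis orthonormal and positively oriented. -/
theorem IsAdapted.B_basis {e : Basis (Fin 7) ℝ V} {φ : V [⋀^Fin 3]→L[ℝ] ℝ} (h : IsAdapted e φ)
    (i j : Fin 7) : B φ (e i) (e j) e = if i = j then 1 else 0 := by
  have key := congrArg (fun n : ℤ => (n : ℝ)) (sum_sign_mul_eps i j)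
  simp only [Int.cast_sum, Int.cast_mul, Int.cast_ite, Int.cast_ofNat, Int.cast_zero] at key
  simp only [B, contract_apply, h _ _ _]
  rw [key]
  split_ifs <;> norm_num

theorem IsAdapted.B_eq {e : Basis (Fin 7) ℝ V} {φ : V [⋀^Fin 3]→L[ℝ] ℝ} (h : IsAdapted e φ)
    (u v : V) (w : Fin 7 → V) : B φ u v w = (∑ k, e.repr u k * e.repr v k) * e.det w := by
  rw [B_eq_mul_det e]
  congr 1
  have hB (u v : V) : B φ u v e = (1 / 144) * ∑ σ : Equiv.Perm (Fin 7),
      ((Equiv.Perm.sign σ : ℤ) : ℝ) * (triLin φ u (e (σ 0)) (e (σ 1)) *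
        triLin φ v (e (σ 2)) (e (σ 3)) * triLin φ (e (σ 4)) (e (σ 5)) (e (σ 6))) := by
    rw [B, ← mul_assoc]
    congr 1
    norm_num
  let bil : V →ₗ[ℝ] V →ₗ[ℝ] ℝ := LinearMap.mk₂ ℝ (fun u v => B φ u v e)
    (fun _ _ _ => by
      simp only [hB, map_add, LinearMap.add_apply, add_mul, mul_add, Finset.sum_add_distrib])
    (fun r _ _ => by
      simp only [hB, map_smul, LinearMap.smul_apply, smul_eq_mul, Finset.mul_sum]
      exact Finset.sum_congr rfl fun _ _ => by ring)
    (fun _ _ _ => by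
      simp only [hB, map_add, LinearMap.add_apply, add_mul, mul_add, Finset.sum_add_distrib])
    (fun r _ _ => by
      simp only [hB, map_smul, LinearMap.smul_apply, smul_eq_mul, Finset.mul_sum]
      exact Finset.sum_congr rfl fun _ _ => by ring)
  change bil u v = _
  conv_lhs => rw [← e.sum_repr u, ← e.sum_repr v]
  simp only [map_sum, map_smul, LinearMap.sum_apply, LinearMap.smul_apply, smul_eq_mul]
  refine Finset.sum_congr rfl fun k _ => ?_
  rw [Finset.sum_eq_single k]
  · change _ * (_ * B φ (e k) (e k) e) = _
    rw [h.B_basis, if_pos rfl, mul_one, mul_comm]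
  · intro j _ hj
    change _ * B φ (e j) (e k) e = _
    rw [h.B_basis, if_neg hj, mul_zero]
  · simp

end Adapted

end G2

end

noncomputable section

namespace G2

/-! ### The metric operations in an adapted basis -/

section AdaptedMetric

open Module

section Insert

variable {V : Type*} [AddCommGroup V] [Module ℝ V] [TopologicalSpace V]

theorem insertVecs_add {q p : ℕ} (v : Fin p → V) (η η' : V [⋀^Fin (q + p)]→L[ℝ] ℝ) :
    insertVecs p v (η + η') = insertVecs p v η + insertVecs p v η' := by
  induction p with
  | zero => rfl
  | succ p ih => exact ih (Fin.tail v) (contract (n := q + p) (v 0) η) (contract (v 0) η')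

theorem insertVecs_smul {q p : ℕ} (v : Fin p → V) (c : ℝ) (η : V [⋀^Fin (q + p)]→L[ℝ] ℝ) :
    insertVecs p v (c • η) = c • insertVecs p v η := by
  induction p with
  | zero => rfl
  | succ p ih => exact ih (Fin.tail v) (contract (n := q + p) (v 0) η)

theorem contract_add_left {n : ℕ} (u v : V) (η : V [⋀^Fin (n + 1)]→L[ℝ] ℝ) :
    contract (u + v) η = contract u η + contract v η := by
  ext w
  exact η.toMultilinearMap.cons_add w u v

theorem contract_smul_left {n : ℕ} (c : ℝ) (v : V) (η : V [⋀^Fin (n + 1)]→L[ℝ] ℝ) :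
    contract (c • v) η = c • contract v η := by
  ext w
  exact η.toMultilinearMap.cons_smul w c v

/-- Insertion of vectors is multilinear in the vectors. -/
def insertMultilinear {q p : ℕ} (η : V [⋀^Fin (q + p)]→L[ℝ] ℝ) (w : Fin q → V) :
    MultilinearMap ℝ (fun _ : Fin p => V) ℝ where
  toFun v := insertVecs p v η w
  map_update_add' := by
    intro inst v i x y
    obtain rfl : inst = instDecidableEqFin p := Subsingleton.elim _ _
    change insertVecs p _ η w = insertVecs p _ η w + insertVecs p _ η w
    induction p with
    | zero => exact i.elim0
    | succ p ih =>
      refine Fin.cases ?_ (fun i => ?_) i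
      · simp only [insertVecs, Fin.tail_update_zero, Function.update_self, contract_add_left,
          insertVecs_add]
        rfl
      · simp only [insertVecs, Fin.tail_update_succ]
        exact ih (contract (n := q + p) (v 0) η) (Fin.tail v) i
  map_update_smul' := by
    intro inst v i c x
    obtain rfl : inst = instDecidableEqFin p := Subsingleton.elim _ _
    change insertVecs p _ η w = c • insertVecs p _ η w
    induction p with
    | zero => exact i.elim0
    | succ p ih =>
      refine Fin.cases ?_ (fun i => ?_) i
      · simp only [insertVecs, Fin.tail_update_zero, Function.update_self, contract_smul_left,
          insertVecs_smul]
        rfl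
      · simp only [insertVecs, Fin.tail_update_succ]
        exact ih (contract (n := q + p) (v 0) η) (Fin.tail v) i

end Insert

theorem root9_pow (t : ℝ) : root9 (t ^ 9) = t := by
  have h : |t ^ 9| ^ (1 / 9 : ℝ) = |t| := by
    rw [abs_pow, ← Real.rpow_natCast, ← Real.rpow_mul (abs_nonneg t)]
    norm_num
  rw [root9, h]
  rcases lt_trichotomy t 0 with ht | rfl | ht
  · rw [sign_neg (Odd.pow_neg (by decide) ht), abs_of_neg ht]; simp
  · simp
  · rw [sign_pos (pow_pos ht 9), abs_of_pos ht]; simp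

variable {V : Type*} [AddCommGroup V] [Module ℝ V] [TopologicalSpace V]
  {e : Basis (Fin 7) ℝ V} {φ : V [⋀^Fin 3]→L[ℝ] ℝ}

theorem IsAdapted.Bmat_eq (h : IsAdapted e φ) (b : Basis (Fin 7) ℝ V) :
    Bmat b φ = e.det b • ((e.toMatrix b).transpose * e.toMatrix b) := by
  ext i j
  simp only [Bmat, Matrix.of_apply, h.B_eq, Matrix.smul_apply, Matrix.mul_apply,
    Matrix.transpose_apply, Basis.toMatrix_apply, smul_eq_mul]
  rw [mul_comm]

/-- The exponent is `9 = 7 + 2`: the scalar factor of a `7 × 7` matrix contributes `7`, and the Gram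
product contributes `2`. This is why `volCoeff` takes a ninth root, which is unambiguous because `9`
is odd. -/
theorem IsAdapted.det_Bmat (h : IsAdapted e φ) (b : Basis (Fin 7) ℝ V) :
    (Bmat b φ).det = e.det b ^ 9 := by
  rw [h.Bmat_eq, Matrix.det_smul, Matrix.det_mul, Matrix.det_transpose, Basis.det_apply,
    Fintype.card_fin]
  ring

theorem IsAdapted.volCoeff_eq (h : IsAdapted e φ) (b : Basis (Fin 7) ℝ V) :
    volCoeff b φ = e.det b := by
  rw [volCoeff, h.det_Bmat, root9_pow]

theorem IsAdapted.gram_eq (h : IsAdapted e φ) (b : Basis (Fin 7) ℝ V) :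
    gram b φ = (e.toMatrix b).transpose * e.toMatrix b := by
  rw [gram, h.volCoeff_eq, h.Bmat_eq, smul_smul, inv_mul_cancel₀ (e.isUnit_det b).ne_zero, one_smul]

theorem IsAdapted.gramInv_eq (h : IsAdapted e φ) (b : Basis (Fin 7) ℝ V) :
    gramInv b φ = b.toMatrix e * (b.toMatrix e).transpose := by
  rw [gramInv, h.gram_eq]
  refine Matrix.inv_eq_right_inv ?_
  calc (e.toMatrix b).transpose * e.toMatrix b * (b.toMatrix e * (b.toMatrix e).transpose)
      = (e.toMatrix b).transpose * (e.toMatrix b * b.toMatrix e) * (b.toMatrix e).transpose := by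
        simp only [Matrix.mul_assoc]
    _ = 1 := by
        rw [e.toMatrix_mul_toMatrix_flip b, Matrix.mul_one, ← Matrix.transpose_mul,
          b.toMatrix_mul_toMatrix_flip e, Matrix.transpose_one]

/-- Contraction of a pair of multilinear maps with the inverse metric. -/
theorem IsAdapted.sum_gramInv_mul (h : IsAdapted e φ) (b : Basis (Fin 7) ℝ V) {p : ℕ}
    (F G : MultilinearMap ℝ (fun _ : Fin p => V) ℝ) :
    ∑ i : Fin p → Fin 7, (∑ j : Fin p → Fin 7, (∏ a, gramInv b φ (i a) (j a)) *
      G (fun a => b (j a))) * F (fun a => b (i a)) =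
    ∑ k : Fin p → Fin 7, G (fun a => e (k a)) * F (fun a => e (k a)) := by
  have expand (H : MultilinearMap ℝ (fun _ : Fin p => V) ℝ) (k : Fin p → Fin 7) :
      H (fun a => e (k a)) =
        ∑ i : Fin p → Fin 7, (∏ a, b.toMatrix e (i a) (k a)) * H (fun a => b (i a)) := by
    have : (fun a => e (k a)) = fun a => ∑ i, b.toMatrix e i (k a) • b i := by
      funext a
      rw [b.sum_toMatrix_smul_self]
    rw [this, H.map_sum]
    refine Finset.sum_congr rfl fun i _ => ?_
    rw [H.map_smul_univ, smul_eq_mul]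
  have hprod (i j : Fin p → Fin 7) : ∏ a, gramInv b φ (i a) (j a) =
      ∑ k : Fin p → Fin 7, (∏ a, b.toMatrix e (i a) (k a)) * ∏ a, b.toMatrix e (j a) (k a) := by
    simp only [h.gramInv_eq, Matrix.mul_apply, Matrix.transpose_apply]
    rw [Finset.prod_univ_sum, Fintype.piFinset_univ]
    exact Finset.sum_congr rfl fun k _ => Finset.prod_mul_distrib
  simp only [expand, hprod, Finset.sum_mul, Finset.mul_sum]
  rw [Finset.sum_comm_cycle]
  refine Finset.sum_congr rfl fun k _ => ?_
  refine Finset.sum_congr rfl fun i _ => Finset.sum_congr rfl fun j _ => ?_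
  ring

/-- The inverse metric is `∑ₖ eₖ ⊗ eₖ`, whichever basis `b` is used to write it. -/
theorem IsAdapted.sum_gramInv_smul (h : IsAdapted e φ) (b : Basis (Fin 7) ℝ V) (f : V →ₗ[ℝ] ℝ) :
    ∑ i, ∑ j, (gramInv b φ i j * f (b j)) • b i = ∑ k, f (e k) • e k := by
  have hk (k : Fin 7) : f (e k) • e k =
      ∑ i, ∑ j, (b.toMatrix e i k * b.toMatrix e j k * f (b j)) • b i := by
    conv_lhs => rw [← b.sum_toMatrix_smul_self e k]
    simp only [map_sum, map_smul, smul_eq_mul, Finset.smul_sum, smul_smul]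
    refine Finset.sum_congr rfl fun i _ => ?_
    rw [Finset.sum_mul, Finset.sum_smul]
    refine Finset.sum_congr rfl fun j _ => ?_
    congr 1
    ring
  simp only [hk, h.gramInv_eq, Matrix.mul_apply, Matrix.transpose_apply, Finset.sum_mul,
    Finset.sum_smul]
  rw [Finset.sum_comm_cycle]

theorem IsAdapted.sharp_eq (h : IsAdapted e φ) (b : Basis (Fin 7) ℝ V)
    (α : V [⋀^Fin 1]→L[ℝ] ℝ) : sharp b φ α = ∑ k, α ![e k] • e k :=
  h.sum_gramInv_smul b
    { toFun := fun v => α ![v]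
      map_add' := fun u v => α.toMultilinearMap.cons_add ![] u v
      map_smul' := fun c v => α.toMultilinearMap.cons_smul ![] c v }

variable [IsTopologicalAddGroup V] [ContinuousSMul ℝ V]

theorem IsAdapted.raise_apply (h : IsAdapted e φ) (b : Basis (Fin 7) ℝ V)
    (s : V →L[ℝ] V →L[ℝ] ℝ) (v : V) : raise b φ s v = ∑ k, s (e k) v • e k := by
  have key := h.sum_gramInv_smul b
    { toFun := fun u => s u v
      map_add' := fun u u' => by simp
      map_smul' := fun c u => by simp }
  refine Eq.trans ?_ key
  simp [raise, smul_smul]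

variable [T2Space V]

theorem coordL_apply (b : Basis (Fin 7) ℝ V) (i : Fin 7) (v : V) : coordL b i v = b.repr v i := rfl

theorem IsAdapted.metric_apply (h : IsAdapted e φ) (b : Basis (Fin 7) ℝ V) (u v : V) :
    metric b φ u v = ∑ k, e.repr u k * e.repr v k := by
  have hrepr (w : V) (k : Fin 7) : e.repr w k = ∑ i, e.toMatrix b k i * b.repr w i := by
    rw [← congrFun (Basis.toMatrix_mulVec_repr b e w) k]; rfl
  simp only [metric, sum_apply, smul_apply, ContinuousLinearMap.smulRight_apply,
    smul_eq_mul, coordL_apply, h.gram_eq, Matrix.mul_apply, Matrix.transpose_apply, hrepr,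
    Finset.sum_mul, Finset.mul_sum]
  rw [Finset.sum_comm_cycle]
  refine Finset.sum_congr rfl fun k _ => ?_
  rw [Finset.sum_comm]
  refine Finset.sum_congr rfl fun i _ => Finset.sum_congr rfl fun j _ => ?_
  ring

theorem IsAdapted.vol_apply (h : IsAdapted e φ) (b : Basis (Fin 7) ℝ V) (w : Fin 7 → V) :
    vol b φ w = e.det w := by
  change volCoeff b φ * b.det w = _
  rw [h.volCoeff_eq]
  conv_rhs => rw [e.det.eq_smul_basis_det b]
  rfl

/-- The inverse metrics that raise the `p` indices collapse to a single sum over the orthonormal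
basis `e`, so the star does not depend on `b`. -/
theorem IsAdapted.star_apply (h : IsAdapted e φ) (b : Basis (Fin 7) ℝ V) {p q : ℕ}
    (hpq : q + p = 7) (α : V [⋀^Fin p]→L[ℝ] ℝ) (w : Fin q → V) :
    star b φ p q hpq α w = (1 / (p.factorial : ℝ)) * ∑ k : Fin p → Fin 7,
      α (fun a => e (k a)) * insertVecs p (fun a => e (k a)) (hpq ▸ vol b φ) w := by
  have key := h.sum_gramInv_mul b (insertMultilinear (hpq ▸ vol b φ) w) α.toMultilinearMap
  change _ = ∑ k : Fin p → Fin 7,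
      α (fun a => e (k a)) * insertVecs p (fun a => e (k a)) (hpq ▸ vol b φ) w at key
  rw [← key]
  simp only [star, ContinuousAlternatingMap.smul_apply, ContinuousAlternatingMap.sum_apply,
    smul_eq_mul]
  rfl

end AdaptedMetric

end G2

end

noncomputable section

namespace G2

/-! ### Linear algebra of a positive form -/

section Positive

open Module

/-! Alternating sums over the omission of one entry of an explicit tuple. -/

section AltSum

variable {α : Type*}

theorem altSum_vec4 (G : α → (Fin 3 → α) → ℝ) (a b c d : α) :
    ∑ i : Fin 4, (-1) ^ (i : ℕ) • G (![a, b, c, d] i) (i.removeNth ![a, b, c, d]) =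
      G a ![b, c, d] - G b ![a, c, d] + G c ![a, b, d] - G d ![a, b, c] := by
  have r (i : Fin 4) : i.removeNth ![a, b, c, d] =
      ![![b, c, d], ![a, c, d], ![a, b, d], ![a, b, c]] i := by
    fin_cases i <;> (ext j; fin_cases j <;> rfl)
  simp only [r, Fin.sum_univ_four]
  simp
  ring

theorem altSum_vec5 (G : α → (Fin 4 → α) → ℝ) (a b c d e : α) :
    ∑ i : Fin 5, (-1) ^ (i : ℕ) • G (![a, b, c, d, e] i) (i.removeNth ![a, b, c, d, e]) =
      G a ![b, c, d, e] - G b ![a, c, d, e] + G c ![a, b, d, e]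
      - G d ![a, b, c, e] + G e ![a, b, c, d] := by
  have r (i : Fin 5) : i.removeNth ![a, b, c, d, e] =
      ![![b, c, d, e], ![a, c, d, e], ![a, b, d, e], ![a, b, c, e], ![a, b, c, d]] i := by
    fin_cases i <;> (ext j; fin_cases j <;> rfl)
  simp only [r, Fin.sum_univ_five]
  simp
  ring

theorem altSum_vec6 (G : α → (Fin 5 → α) → ℝ) (a b c d e f : α) :
    ∑ i : Fin 6, (-1) ^ (i : ℕ) • G (![a, b, c, d, e, f] i) (i.removeNth ![a, b, c, d, e, f]) =
      G a ![b, c, d, e, f] - G b ![a, c, d, e, f] + G c ![a, b, d, e, f]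
      - G d ![a, b, c, e, f] + G e ![a, b, c, d, f] - G f ![a, b, c, d, e] := by
  have r (i : Fin 6) : i.removeNth ![a, b, c, d, e, f] =
      ![![b, c, d, e, f], ![a, c, d, e, f], ![a, b, d, e, f], ![a, b, c, e, f],
        ![a, b, c, d, f], ![a, b, c, d, e]] i := by
    fin_cases i <;> (ext j; fin_cases j <;> rfl)
  simp only [r, Fin.sum_univ_six]
  simp
  ring

end AltSum

section Alternating

variable {V : Type*} [AddCommGroup V] [Module ℝ V]

/-- Alternating maps agree if they agree on strictly increasing tuples of basis vectors. -/
theorem alternatingMap_ext_strictMono {n p : ℕ} (e : Basis (Fin n) ℝ V)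
    {F G : V [⋀^Fin p]→ₗ[ℝ] ℝ}
    (h : ∀ f : Fin p → Fin n, StrictMono f → F (fun a => e (f a)) = G (fun a => e (f a))) :
    F = G := by
  refine Basis.ext_alternating e fun f hf => ?_
  have hmono : StrictMono (f ∘ Tuple.sort f) :=
    (Tuple.monotone_sort f).strictMono_of_injective (hf.comp (Tuple.sort f).injective)
  have h1 := h _ hmono
  have h2 (H : V [⋀^Fin p]→ₗ[ℝ] ℝ) : H (fun a => e ((f ∘ Tuple.sort f) a)) =
      Equiv.Perm.sign (Tuple.sort f) • H (fun a => e (f a)) :=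
    H.map_perm (fun a => e (f a)) (Tuple.sort f)
  rw [h2, h2] at h1
  exact smul_left_cancel _ h1

/-- Twice the wedge product of a bilinear alternating form and a `3`-form. -/
def wedge23 (β : V →ₗ[ℝ] V →ₗ[ℝ] ℝ) (γ : V [⋀^Fin 3]→ₗ[ℝ] ℝ) : V [⋀^Fin 5]→ₗ[ℝ] ℝ :=
  AlternatingMap.alternatizeUncurryFin (AlternatingMap.alternatizeUncurryFinLM.comp
    (β.compr₂ (LinearMap.toSpanSingleton ℝ _ γ)))

/-- Realises the shuffle sum as a genuine alternating map, so that it can be compared on increasing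
basis tuples. The double alternation runs over ordered pairs and meets each shuffle twice, hence the
factor `2`. -/
theorem wedge23_apply (β : V →ₗ[ℝ] V →ₗ[ℝ] ℝ) (hβ : ∀ u v, β u v = -β v u)
    (γ : V [⋀^Fin 3]→ₗ[ℝ] ℝ) (a b c d e : V) : wedge23 β γ ![a, b, c, d, e] =
    2 * shuffle23 (fun u v => β u v) (fun u v w => γ ![u, v, w]) a b c d e := by
  have h5 (F : V →ₗ[ℝ] V [⋀^Fin 4]→ₗ[ℝ] ℝ) :=
    (AlternatingMap.alternatizeUncurryFin_apply F ![a, b, c, d, e]).trans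
      (altSum_vec5 (fun u v => F u v) a b c d e)
  have h4 (F : V →ₗ[ℝ] V [⋀^Fin 3]→ₗ[ℝ] ℝ) (a b c d : V) :=
    (AlternatingMap.alternatizeUncurryFin_apply F ![a, b, c, d]).trans
      (altSum_vec4 (fun u v => F u v) a b c d)
  rw [wedge23, h5]
  simp only [LinearMap.comp_apply, AlternatingMap.alternatizeUncurryFinLM_apply, h4,
    LinearMap.compr₂_apply, LinearMap.toSpanSingleton_apply, AlternatingMap.smul_apply,
    smul_eq_mul, shuffle23, hβ b a, hβ c a, hβ d a, hβ e a, hβ c b, hβ d b, hβ e b, hβ d c,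
    hβ e c, hβ e d]
  ring

end Alternating

end Positive

end G2

end

noncomputable section

namespace G2

/-! ### The derivation action on a positive form, and the star of `u ⌟ φ`. -/

section PositiveStar

open Module

variable {V : Type*} [AddCommGroup V] [Module ℝ V] [TopologicalSpace V]
  {e : Basis (Fin 7) ℝ V} {φ : V [⋀^Fin 3]→L[ℝ] ℝ}

theorem form3_swap₁₂ (η : V [⋀^Fin 3]→L[ℝ] ℝ) (a b c : V) : η ![a, b, c] = -η ![b, a, c] := by
  have h := η.toAlternatingMap.map_swap ![b, a, c] (show (0 : Fin 3) ≠ 1 by decide)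
  have : ![b, a, c] ∘ ⇑(Equiv.swap (0 : Fin 3) 1) = ![a, b, c] := by
    ext i; fin_cases i <;> rfl
  rw [this] at h
  exact h

theorem form3_swap₂₃ (η : V [⋀^Fin 3]→L[ℝ] ℝ) (a b c : V) : η ![a, b, c] = -η ![a, c, b] := by
  have h := η.toAlternatingMap.map_swap ![a, c, b] (show (1 : Fin 3) ≠ 2 by decide)
  have : ![a, c, b] ∘ ⇑(Equiv.swap (1 : Fin 3) 2) = ![a, b, c] := by
    ext i; fin_cases i <;> rfl
  rw [this] at h
  exact h

theorem form3_ext (e : Basis (Fin 7) ℝ V) {η η' : V [⋀^Fin 3]→L[ℝ] ℝ}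
    (h : ∀ i j k, i < j → j < k → η ![e i, e j, e k] = η' ![e i, e j, e k]) : η = η' := by
  have key : η.toAlternatingMap = η'.toAlternatingMap := by
    refine alternatingMap_ext_strictMono e fun f hf => ?_
    have : (fun a => e (f a)) = ![e (f 0), e (f 1), e (f 2)] := by
      ext a; fin_cases a <;> rfl
    rw [this]
    exact h _ _ _ (hf (by decide)) (hf (by decide))
  ext v
  exact congrArg (fun F => F v) key

/-- The components of an endomorphism in a basis. -/
def entry (e : Basis (Fin 7) ℝ V) (A : V →L[ℝ] V) (p q : Fin 7) : ℝ := e.repr (A (e q)) p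

theorem derivAction_vec3 (A : V →L[ℝ] V) (η : V [⋀^Fin 3]→L[ℝ] ℝ) (a b c : V) :
    derivAction A η ![a, b, c] = η ![A a, b, c] + η ![a, A b, c] + η ![a, b, A c] := by
  rw [derivAction_apply, Fin.sum_univ_three]
  congr 2
  · congr 1; ext i; fin_cases i <;> rfl
  · congr 1; ext i; fin_cases i <;> rfl
  · ext i; fin_cases i <;> rfl

theorem IsAdapted.derivAction_basis (h : IsAdapted e φ) (A : V →L[ℝ] V) (i j k : Fin 7) :
    derivAction A φ ![e i, e j, e k] =
      ∑ l, (entry e A l i * eps l j k + entry e A l j * eps i l k + entry e A l k * eps i j l) := by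
  have hA (q : Fin 7) : A (e q) = ∑ p, entry e A p q • e p := (e.sum_repr _).symm
  rw [derivAction_vec3, hA i, hA j, hA k]
  simp only [← triLin_apply, map_sum, map_smul, LinearMap.sum_apply, LinearMap.smul_apply,
    smul_eq_mul, Finset.sum_add_distrib]
  simp only [triLin_apply, h _ _ _]

theorem IsAdapted.derivAction_basis' (h : IsAdapted e φ) (A : V →L[ℝ] V) (i j k : Fin 7) :
    derivAction A φ ![e i, e j, e k] = ∑ p, ∑ q, entry e A p q * epsAction p q i j k := by
  rw [h.derivAction_basis]
  refine Finset.sum_congr rfl fun p _ => ?_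
  have hb (q i : Fin 7) (r : ℤ) : (((bif q.val.beq i.val then r else 0 : ℤ)) : ℝ) =
      if q = i then (r : ℝ) else 0 := by
    by_cases hq : q = i
    · subst hq; simp
    · have : q.val.beq i.val = false := by
        rw [← Bool.not_eq_true, Nat.beq_eq]
        exact fun h' => hq (Fin.ext h')
      simp [hq, this]
  simp only [epsAction, Int.cast_add, hb, mul_add, Finset.sum_add_distrib, mul_ite, mul_zero,
    Finset.sum_ite_eq', Finset.mem_univ, if_true]

/-- Every `3`-form is the derivative of a positive form along some endomorphism. -/
theorem IsAdapted.exists_derivAction_eq [IsTopologicalAddGroup V] [ContinuousSMul ℝ V] [T2Space V]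
    (h : IsAdapted e φ) (η : V [⋀^Fin 3]→L[ℝ] ℝ) : ∃ A : V →L[ℝ] V, η = derivAction A φ := by
  have : FiniteDimensional ℝ V := Module.Finite.of_basis e
  -- Expand `η` in the forms `eᵖ ∧ e^q ∧ eʳ` with `p < q < r` and use the explicit preimage of each;
  -- `1 / 6` undoes the scaling of `epsInv`.
  let a : Matrix (Fin 7) (Fin 7) ℝ := Matrix.of fun l i => (1 / 6) * ∑ p, ∑ q, ∑ r,
    if p < q ∧ q < r then η ![e p, e q, e r] * epsInv p q r l i else 0
  let A : V →L[ℝ] V := LinearMap.toContinuousLinearMap (Matrix.toLin e e a)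
  have hA (l i : Fin 7) : entry e A l i = a l i := by
    change e.repr (Matrix.toLin e e a (e i)) l = _
    rw [Matrix.toLin_self]
    simp [Finsupp.single_apply]
  refine ⟨A, form3_ext e fun i j k hij hjk => ?_⟩
  rw [h.derivAction_basis]
  have hcoef (p q r : Fin 7) (hpq : p < q) (hqr : q < r) :
      ∑ l, ((epsInv p q r l i : ℝ) * eps l j k +
          epsInv p q r l j * eps i l k +
        epsInv p q r l k * eps i j l) = if p = i ∧ q = j ∧ r = k then 6 else 0 := by
    have := congrArg (fun n : ℤ => (n : ℝ)) (epsInv_action p q hpq r hqr i j hij k hjk)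
    simp only [lazyMul_eq] at this
    push_cast at this
    rw [← this]
    exact Finset.sum_congr rfl fun l _ => by ring
  have hsum : ∑ l, (entry e A l i * eps l j k + entry e A l j * eps i l k +
      entry e A l k * eps i j l) = (1 / 6) * ∑ p, ∑ q, ∑ r, if p < q ∧ q < r then
        η ![e p, e q, e r] * ∑ l, ((epsInv p q r l i : ℝ) * eps l j k +
          epsInv p q r l j * eps i l k +
        epsInv p q r l k * eps i j l) else 0 := by
    have hentry (l i : Fin 7) : entry e A l i = ∑ p, ∑ q, ∑ r, (1 / 6) *
      if p < q ∧ q < r then η ![e p, e q, e r] * epsInv p q r l i else 0 := by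
      rw [hA]
      simp only [a, Matrix.of_apply, Finset.mul_sum]
    simp only [hentry, Finset.sum_mul, Finset.mul_sum, ← Finset.sum_add_distrib]
    rw [Finset.sum_comm]
    refine Finset.sum_congr rfl fun p _ => ?_
    rw [Finset.sum_comm]
    refine Finset.sum_congr rfl fun q _ => ?_
    rw [Finset.sum_comm]
    refine Finset.sum_congr rfl fun r _ => ?_
    split_ifs
    · rw [Finset.mul_sum]
      exact Finset.sum_congr rfl fun l _ => by ring
    · simp
  rw [hsum]
  have hterm (p q r : Fin 7) : (if p < q ∧ q < r then η ![e p, e q, e r] *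
      ∑ l, ((epsInv p q r l i : ℝ) * eps l j k +
          epsInv p q r l j * eps i l k +
        epsInv p q r l k * eps i j l) else 0) =
      if r = k then if q = j then if p = i then 6 * η ![e i, e j, e k] else 0 else 0 else 0 := by
    by_cases hpqr : p < q ∧ q < r
    · rw [if_pos hpqr, hcoef p q r hpqr.1 hpqr.2]
      by_cases hp : p = i <;> by_cases hq : q = j <;> by_cases hr : r = k <;>
        simp [hp, hq, hr, mul_comm]
    · rw [if_neg hpqr]
      by_cases hp : p = i <;> by_cases hq : q = j <;> by_cases hr : r = k <;> simp [hp, hq, hr]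
      subst hp hq hr
      exact absurd ⟨hij, hjk⟩ hpqr
  simp only [hterm, Finset.sum_ite_eq', Finset.mem_univ, if_true]
  ring

variable [IsTopologicalAddGroup V] [ContinuousSMul ℝ V] [T2Space V]

/-- For a positive form, `*(u ⌟ φ) = ½ (u ⌟ φ) ∧ φ`. -/
theorem IsAdapted.star_contract (h : IsAdapted e φ) (b : Basis (Fin 7) ℝ V) (u : V)
    (v₀ v₁ v₂ v₃ v₄ : V) :
    star b φ 2 5 rfl (contract u φ) ![v₀, v₁, v₂, v₃, v₄] =
      (1 / 2) * shuffle23 (fun x y => φ ![u, x, y]) (fun x y z => φ ![x, y, z]) v₀ v₁ v₂ v₃ v₄ := by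
  have hstar (u : V) (w : Fin 5 → V) : star b φ 2 5 rfl (contract u φ) w =
      (1 / 2) * ∑ p, ∑ q, φ ![u, e p, e q] *
        e.det (Matrix.vecCons (e p) (Matrix.vecCons (e q) w)) := by
    rw [h.star_apply]
    simp only [sum_fin_succ_fun, sum_fin_zero_fun]
    congr 1
    refine Finset.sum_congr rfl fun p _ => Finset.sum_congr rfl fun q _ => ?_
    rw [contract_apply]
    congr 1
    · congr 1; ext i; fin_cases i <;> rfl
    · exact h.vol_apply b _
  -- For basis vectors the identity is a finite check on increasing tuples; linearity in `u` then
  -- gives the general case. Here `1 / 4 = ½ · ½`, since `wedge23` is twice the wedge product.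
  have hbasis (i : Fin 7) : (star b φ 2 5 rfl (contract (e i) φ)).toAlternatingMap =
      (1 / 4 : ℝ) • wedge23 (triLin φ (e i)) φ.toAlternatingMap := by
    refine alternatingMap_ext_strictMono e fun f hf => ?_
    have hw : (fun a => e (f a)) = ![e (f 0), e (f 1), e (f 2), e (f 3), e (f 4)] := by
      ext a; fin_cases a <;> rfl
    have hdet (p q : Fin 7) : e.det (Matrix.vecCons (e p) (Matrix.vecCons (e q)
        ![e (f 0), e (f 1), e (f 2), e (f 3), e (f 4)])) =
        leviCivita p q (f 0) (f 1) (f 2) (f 3) (f 4) := basis_det_vec e _ _ _ _ _ _ _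
    have key := congrArg (fun n : ℤ => (n : ℝ)) (epsSum_leviCivita_eq_shuffle23 i (f 0) (f 1)
      (hf (by decide)) (f 2) (hf (by decide)) (f 3) (hf (by decide)) (f 4) (hf (by decide)))
    rw [← sum_eps_mul] at key
    push_cast at key
    rw [hw, ContinuousAlternatingMap.coe_toAlternatingMap, hstar, AlternatingMap.smul_apply,
      wedge23_apply _ fun u v => form3_swap₂₃ φ _ _ _]
    simp only [hdet, h _ _ _, key, smul_eq_mul, shuffle23, triLin_apply,
      ContinuousAlternatingMap.coe_toAlternatingMap]
    push_cast
    ring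
  have hb (i : Fin 7) : star b φ 2 5 rfl (contract (e i) φ) ![v₀, v₁, v₂, v₃, v₄] =
      (1 / 2) * shuffle23 (fun x y => φ ![e i, x, y]) (fun x y z => φ ![x, y, z])
        v₀ v₁ v₂ v₃ v₄ := by
    have := congrArg (fun F => F ![v₀, v₁, v₂, v₃, v₄]) (hbasis i)
    simp only [AlternatingMap.smul_apply] at this
    rw [wedge23_apply _ fun u v => form3_swap₂₃ φ _ _ _] at this
    refine Eq.trans this ?_
    simp only [triLin_apply, ContinuousAlternatingMap.coe_toAlternatingMap, smul_eq_mul]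
    ring
  have hu : u = ∑ i, e.repr u i • e i := (e.sum_repr u).symm
  have hexp (x y : V) : φ ![u, x, y] = ∑ i, e.repr u i * φ ![e i, x, y] := by
    conv_lhs => rw [hu]
    simp only [← triLin_apply, map_sum, map_smul, LinearMap.sum_apply, LinearMap.smul_apply,
      smul_eq_mul]
  have hL : star b φ 2 5 rfl (contract u φ) ![v₀, v₁, v₂, v₃, v₄] =
      ∑ i, e.repr u i * star b φ 2 5 rfl (contract (e i) φ) ![v₀, v₁, v₂, v₃, v₄] := by
    simp only [hstar, hexp, Finset.sum_mul, Finset.mul_sum]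
    rw [Finset.sum_comm_cycle]
    refine Finset.sum_congr rfl fun i _ => Finset.sum_congr rfl fun p _ =>
      Finset.sum_congr rfl fun q _ => ?_
    ring
  rw [hL]
  simp only [hb, shuffle23, hexp, Finset.sum_mul, Finset.mul_sum, ← Finset.sum_add_distrib,
    ← Finset.sum_sub_distrib]
  refine Finset.sum_congr rfl fun i _ => ?_
  ring

end PositiveStar

end G2

end

noncomputable section

namespace G2

/-! ### Splitting `A · φ` into its symmetric and skew contributions. -/

section PositiveDecomposition

open Module

theorem leviCivita_succAbove : ∀ l : Fin 7, leviCivita (l.succAbove 0) (l.succAbove 1)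
    (l.succAbove 2) (l.succAbove 3) (l.succAbove 4) (l.succAbove 5) l = (-1) ^ l.val := by
  decide +kernel

variable {V : Type*} [AddCommGroup V] [Module ℝ V] [TopologicalSpace V]
  [IsTopologicalAddGroup V] [ContinuousSMul ℝ V] [T2Space V]
  {e : Basis (Fin 7) ℝ V} {φ : V [⋀^Fin 3]→L[ℝ] ℝ}

/-- The Hodge star of a `6`-form in an adapted basis. -/
theorem IsAdapted.star_six_one (h : IsAdapted e φ) (b : Basis (Fin 7) ℝ V)
    (α : V [⋀^Fin 6]→L[ℝ] ℝ) (l : Fin 7) :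
    star b φ 6 1 rfl α ![e l] = (-1) ^ l.val * α (fun a => e (l.succAbove a)) := by
  let D (k : Fin 6 → Fin 7) : Fin 7 → Fin 7 := ![k 0, k 1, k 2, k 3, k 4, k 5, l]
  have hD (k : Fin 6 → Fin 7) : insertVecs (q := 1) 6 (fun a => e (k a)) (vol b φ) ![e l] =
      e.det (fun a => e (D k a)) := by
    refine (h.vol_apply b _).trans ?_
    congr 1
    ext a; fin_cases a <;> rfl
  have hDs (k : Fin 6 → Fin 7) (a : Fin 6) : D k a.castSucc = k a := by
    fin_cases a <;> rfl
  have hDl (k : Fin 6 → Fin 7) : D k (Fin.last 6) = l := rfl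
  -- A repeated index kills `α` and an index equal to `l` kills the determinant, so only the
  -- orderings of the complement of `l` remain. The signs from `α` and from the determinant cancel,
  -- so all `6!` terms are equal.
  have hsum : ∑ k : Fin 6 → Fin 7, α (fun a => e (k a)) * e.det (fun a => e (D k a)) =
      ∑ σ : Equiv.Perm (Fin 6), (-1) ^ l.val * α (fun a => e (l.succAbove a)) := by
    symm
    refine Finset.sum_of_injOn (fun σ => fun a => l.succAbove (σ a)) ?_ (by simp) ?_ ?_
    · intro σ _ τ _ hστ
      ext a
      exact congrArg Fin.val (Fin.succAbove_right_injective (congrFun hστ a))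
    · intro k _ hk
      by_cases hinj : Function.Injective k
      · by_cases hl : ∃ a, k a = l
        · obtain ⟨a, ha⟩ := hl
          have : e.det (fun a => e (D k a)) = 0 := by
            refine e.det.map_eq_zero_of_eq _ (i := a.castSucc) (j := Fin.last 6) ?_
              (Fin.castSucc_lt_last a).ne
            simp only [hDs, hDl, ha]
          rw [this, mul_zero]
        · push Not at hl
          refine absurd ?_ hk
          choose τ hτ using fun a => Fin.exists_succAbove_eq (hl a)
          have hτinj : Function.Injective τ := fun x y hxy => hinj (by rw [← hτ x, ← hτ y, hxy])
          exact ⟨Equiv.ofBijective τ (Finite.injective_iff_bijective.1 hτinj), by simp,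
            funext hτ⟩
      · simp only [Function.Injective, not_forall] at hinj
        obtain ⟨x, y, hxy, hne⟩ := hinj
        rw [α.map_eq_zero_of_eq _ (by rw [hxy]) hne, zero_mul]
    · intro σ _
      have h1 : α (fun a => e (l.succAbove (σ a))) =
          Equiv.Perm.sign σ • α (fun a => e (l.succAbove a)) :=
        α.toAlternatingMap.map_perm (fun a => e (l.succAbove a)) σ
      have h2 : e.det (fun a => e (D (fun a => l.succAbove (σ a)) a)) =
          Equiv.Perm.sign σ • e.det (fun a => e (D l.succAbove a)) := by
        -- Extend `σ` to seven slots by fixing the last one, which holds `l`; the sign is unchanged.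
        rw [← Equiv.Perm.viaFintypeEmbedding_sign σ Fin.castSuccEmb, ← e.det.map_perm]
        congr 1
        ext a
        refine Fin.lastCases ?_ (fun a => ?_) a
        · have : σ.viaFintypeEmbedding Fin.castSuccEmb (Fin.last 6) = Fin.last 6 :=
            σ.viaFintypeEmbedding_apply_notMem_range _ fun ⟨x, hx⟩ => (Fin.castSucc_lt_last x).ne hx
          simp only [Function.comp_apply, this, hDl]
        · have : σ.viaFintypeEmbedding Fin.castSuccEmb a.castSucc = (σ a).castSucc :=
            σ.viaFintypeEmbedding_apply_image Fin.castSuccEmb a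
          simp only [Function.comp_apply, this, hDs]
      have h3 : e.det (fun a => e (D l.succAbove a)) = (-1) ^ l.val := by
        refine (basis_det_comp e _).trans ?_
        refine (congrArg (fun n : ℤ => (n : ℝ)) (leviCivita_succAbove l)).trans ?_
        push_cast
        rfl
      have h4 : ((Equiv.Perm.sign σ : ℤ) : ℝ) * ((Equiv.Perm.sign σ : ℤ) : ℝ) = 1 := by
        rw [← Int.cast_mul, ← Units.val_mul, Int.units_mul_self]
        simp
      rw [h1, h2, h3, Units.smul_def, Units.smul_def, zsmul_eq_mul, zsmul_eq_mul]
      linear_combination (-((-1) ^ l.val * α fun a => e (l.succAbove a))) * h4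
  rw [h.star_apply]
  have : ∑ k : Fin 6 → Fin 7, α (fun a => e (k a)) *
      insertVecs (q := 1) 6 (fun a => e (k a)) (vol b φ) ![e l] =
      720 * ((-1) ^ l.val * α (fun a => e (l.succAbove a))) := by
    simp only [hD]
    rw [hsum, Finset.sum_const, Finset.card_univ, Fintype.card_perm, Fintype.card_fin,
      nsmul_eq_mul]
    norm_num [Nat.factorial]
  change 1 / ((Nat.factorial 6 : ℕ) : ℝ) * (∑ k : Fin 6 → Fin 7, α (fun a => e (k a)) *
      insertVecs (q := 1) 6 (fun a => e (k a)) (vol b φ) ![e l]) = _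
  rw [this]
  norm_num [Nat.factorial]
  ring

theorem IsAdapted.psi_basis (h : IsAdapted e φ) (b : Basis (Fin 7) ℝ V) (l i j k : Fin 7)
    (hij : i < j) (hjk : j < k) : psi b φ ![e l, e i, e j, e k] = epsDual l i j k := by
  have key := congrArg (fun n : ℤ => (n : ℝ)) (sum_epsSum_leviCivita_eq_epsDual l i j hij k hjk)
  simp only [← sum_eps_mul] at key
  push_cast at key
  rw [psi, h.star_apply]
  simp only [sum_fin_succ_fun, sum_fin_zero_fun]
  have hterm (p q r : Fin 7) : φ (fun a => e (![p, q, r] a)) *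
      insertVecs (q := 4) 3 (fun a => e (![p, q, r] a)) (vol b φ) ![e l, e i, e j, e k] =
      eps p q r * leviCivita p q r l i j k := by
    congr 1
    · rw [← h]
      congr 1; ext a; fin_cases a <;> rfl
    · exact (h.vol_apply b _).trans (basis_det_vec e _ _ _ _ _ _ _)
  simp only [hterm]
  rw [key]
  norm_num [Nat.factorial]
  ring

/-- Decomposition of the derivative of a positive form along an endomorphism `A`: the symmetric
part of `A` contributes through `iPhi`, its skew part through the `1`-form
`θ = ½ *((A · φ) ∧ φ)`. -/
theorem IsAdapted.derivAction_eq (h : IsAdapted e φ) (b : Basis (Fin 7) ℝ V) (A : V →L[ℝ] V)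
    (s : V →L[ℝ] V →L[ℝ] ℝ) (hs : ∀ u v, s u v = metric b φ (A u) v + metric b φ u (A v))
    (θ : V [⋀^Fin 1]→L[ℝ] ℝ)
    (hθ : ∀ l : Fin 7, θ ![e l] = (1 / 2) * ((-1) ^ l.val * shuffle33
      (fun x y z => derivAction A φ ![x, y, z]) (fun x y z => φ ![x, y, z])
      (e (l.succAbove 0)) (e (l.succAbove 1)) (e (l.succAbove 2)) (e (l.succAbove 3))
      (e (l.succAbove 4)) (e (l.succAbove 5)))) :
    derivAction A φ = (1 / 2 : ℝ) • iPhi b φ s +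
      (1 / 2 : ℝ) • contract (sharp b φ θ) (psi b φ) := by
  have hθ' (l : Fin 7) : θ ![e l] = -∑ p, ∑ q, entry e A p q * eps l p q := by
    have key (p q : Fin 7) := congrArg (fun n : ℤ => (n : ℝ)) (shuffle33_epsAction l p q)
    simp only [shuffle33] at key
    push_cast at key
    have key' (p q : Fin 7) : (eps l p q : ℝ) = -(1 / 2) * (-2 * eps l p q) := by ring
    simp only [← key] at key'
    rw [hθ]
    simp only [shuffle33, h.derivAction_basis', h _ _ _, key', Finset.sum_mul,
      Finset.mul_sum, ← Finset.sum_add_distrib, ← Finset.sum_sub_distrib, ← Finset.sum_neg_distrib]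
    refine Finset.sum_congr rfl fun p _ => Finset.sum_congr rfl fun q _ => ?_
    ring
  -- In the orthonormal basis, raising an index of `s` gives `A + Aᵀ`.
  have hraise (p q : Fin 7) : entry e (raise b φ s) p q = entry e A p q + entry e A q p := by
    rw [entry, h.raise_apply]
    simp only [hs, h.metric_apply, Basis.repr_self, map_sum, map_smul, Finsupp.finsetSum_apply,
      Finsupp.smul_apply, smul_eq_mul, Finsupp.single_apply, mul_ite, mul_one, mul_zero, ite_mul,
      one_mul, zero_mul, Finset.sum_ite_eq', Finset.sum_ite_eq, Finset.mem_univ, if_true, entry]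
    ring
  refine form3_ext e fun i j k hij hjk => ?_
  have hpsi : contract (sharp b φ θ) (psi b φ) ![e i, e j, e k] =
      ∑ l, θ ![e l] * epsDual l i j k := by
    rw [h.sharp_eq]
    have hlin : contract (∑ l, θ ![e l] • e l) (psi b φ) =
        ∑ l, θ ![e l] • contract (e l) (psi b φ) := by
      let F : V →ₗ[ℝ] V [⋀^Fin 3]→L[ℝ] ℝ :=
        { toFun := fun v => contract v (psi b φ)
          map_add' := fun u v => contract_add_left u v _
          map_smul' := fun c v => contract_smul_left c v _ }
      change F _ = ∑ l, θ ![e l] • F (e l)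
      simp only [map_sum, map_smul]
    rw [hlin]
    simp only [ContinuousAlternatingMap.sum_apply, ContinuousAlternatingMap.smul_apply,
      smul_eq_mul]
    refine Finset.sum_congr rfl fun l _ => ?_
    rw [contract_apply, h.psi_basis b l i j k hij hjk]
  have key (p q : Fin 7) :=
    congrArg (fun n : ℤ => (n : ℝ)) (epsAction_sub_epsAction_swap i j k hij hjk p q)
  push_cast at key
  rw [ContinuousAlternatingMap.add_apply, ContinuousAlternatingMap.smul_apply,
    ContinuousAlternatingMap.smul_apply, hpsi, iPhi, h.derivAction_basis', h.derivAction_basis']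
  -- The `ψ` term is the action of `A - Aᵀ`. Together with `A + Aᵀ` from `iPhi`, each with factor
  -- `½`, it restores `A`.
  have hθsum : ∑ l, θ ![e l] * epsDual l i j k = ∑ p, ∑ q, entry e A p q *
      ((epsAction p q i j k : ℝ) - epsAction q p i j k) := by
    simp only [hθ', key, neg_mul, Finset.sum_mul, Finset.mul_sum, mul_neg,
      Finset.sum_neg_distrib]
    rw [Finset.sum_comm_cycle, Finset.sum_comm_cycle]
    congr 1
    refine Finset.sum_congr rfl fun p _ => Finset.sum_congr rfl fun q _ =>
      Finset.sum_congr rfl fun l _ => ?_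
    ring
  have hswap : ∑ p, ∑ q, entry e A q p * (epsAction p q i j k : ℝ) =
      ∑ p, ∑ q, entry e A p q * (epsAction q p i j k : ℝ) := Finset.sum_comm
  simp only [hθsum, hraise, add_mul, mul_sub, Finset.sum_add_distrib, Finset.sum_sub_distrib,
    hswap, smul_eq_mul]
  ring

end PositiveDecomposition

end G2

end

noncomputable section

set_option maxSynthPendingDepth 3

namespace G2

/-! ### Calculus of positive forms on a vector space -/

section Calculus

open Module Filter Topology

/-- The Leibniz rule `d(β ∧ γ) = dβ ∧ γ` for a closed `3`-form `γ`, in terms of the first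
derivatives `β'`, `γ'` of the components. -/
theorem shuffle23_leibniz {ι R : Type*} [CommRing R] (β : ι → ι → R) (γ : ι → ι → ι → R)
    (β' : ι → ι → ι → R) (γ' : ι → ι → ι → ι → R)
    (hγ : ∀ x y z w, γ' x y z w - γ' y x z w + γ' z x y w - γ' w x y z = 0) (a b c d e f : ι) :
    (shuffle23 (β' a) γ b c d e f + shuffle23 β (γ' a) b c d e f)
    - (shuffle23 (β' b) γ a c d e f + shuffle23 β (γ' b) a c d e f)
    + (shuffle23 (β' c) γ a b d e f + shuffle23 β (γ' c) a b d e f)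
    - (shuffle23 (β' d) γ a b c e f + shuffle23 β (γ' d) a b c e f)
    + (shuffle23 (β' e) γ a b c d f + shuffle23 β (γ' e) a b c d f)
    - (shuffle23 (β' f) γ a b c d e + shuffle23 β (γ' f) a b c d e) =
      shuffle33 (fun x y z => β' x y z - β' y x z + β' z x y) γ a b c d e f := by
  simp only [shuffle23, shuffle33]
  -- The terms that differentiate `γ` assemble into `β ∧ dγ`: each component of `β` multiplies the
  -- closedness relation on the complementary four indices, with the shuffle sign.
  linear_combination
    β a b * hγ c d e f - β a c * hγ b d e f + β a d * hγ b c e f - β a e * hγ b c d f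
    + β a f * hγ b c d e + β b c * hγ a d e f - β b d * hγ a c e f + β b e * hγ a c d f
    - β b f * hγ a c d e + β c d * hγ a b e f - β c e * hγ a b d f + β c f * hγ a b d e
    + β d e * hγ a b c f - β d f * hγ a b c e + β e f * hγ a b c d

theorem differentiableAt_root9 {t : ℝ} (ht : t ≠ 0) : DifferentiableAt ℝ root9 t := by
  rcases lt_or_gt_of_ne ht with h | h
  · have : root9 =ᶠ[𝓝 t] fun s => -((-s) ^ (1 / 9 : ℝ)) := by
      filter_upwards [gt_mem_nhds h] with s hs
      rw [root9, sign_neg hs, abs_of_neg hs]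
      simp
    rw [this.differentiableAt_iff]
    exact (differentiableAt_id.neg.rpow_const (Or.inl (neg_ne_zero.2 ht))).neg
  · have : root9 =ᶠ[𝓝 t] fun s => s ^ (1 / 9 : ℝ) := by
      filter_upwards [lt_mem_nhds h] with s hs
      rw [root9, sign_pos hs, abs_of_pos hs]
      simp
    rw [this.differentiableAt_iff]
    exact differentiableAt_id.rpow_const (Or.inl ht)

variable {E : Type*} [NormedAddCommGroup E] [NormedSpace ℝ E]
  {e : Basis (Fin 7) ℝ E} {φ : E [⋀^Fin 3]→L[ℝ] ℝ}

theorem differentiable_Bmat (b : Basis (Fin 7) ℝ E) (i j : Fin 7) :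
    Differentiable ℝ fun η : E [⋀^Fin 3]→L[ℝ] ℝ => Bmat b η i j := by
  simp only [Bmat, Matrix.of_apply, B, contract_apply]
  fun_prop

theorem differentiable_det_Bmat (b : Basis (Fin 7) ℝ E) :
    Differentiable ℝ fun η : E [⋀^Fin 3]→L[ℝ] ℝ => (Bmat b η).det := by
  intro η
  simp only [Matrix.det_apply]
  refine DifferentiableAt.fun_sum fun σ _ => ?_
  refine DifferentiableAt.const_smul ?_ _
  exact (HasFDerivAt.finsetProd fun i _ =>
    (differentiable_Bmat b (σ i) i η).hasFDerivAt).differentiableAt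

/-- The metric of a `3`-form on a normed space, as an element of a normed space. -/
def normedMetric (b : Basis (Fin 7) ℝ E) (η : E [⋀^Fin 3]→L[ℝ] ℝ) : E →L[ℝ] E →L[ℝ] ℝ :=
  metric b η

theorem normedMetric_eq_sum (b : Basis (Fin 7) ℝ E) (η : E [⋀^Fin 3]→L[ℝ] ℝ) :
    normedMetric b η = ∑ i, ∑ j, ((volCoeff b η)⁻¹ * Bmat b η i j) •
      (coordL b i).smulRight (coordL b j) := rfl

/-- The ninth root is differentiable away from `0`, and `det B_φ` is the ninth power of a nonzero
determinant when `φ` is positive. -/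
theorem IsAdapted.differentiableAt_metric (h : IsAdapted e φ) (b : Basis (Fin 7) ℝ E) :
    DifferentiableAt ℝ (normedMetric b) φ := by
  have hne : e.det b ≠ 0 := (e.isUnit_det b).ne_zero
  have hdet : (Bmat b φ).det ≠ 0 := by
    rw [h.det_Bmat]
    exact pow_ne_zero _ hne
  have hvol : DifferentiableAt ℝ (fun η => volCoeff b η) φ :=
    (differentiableAt_root9 hdet).comp φ (differentiable_det_Bmat b φ)
  have hvne : volCoeff b φ ≠ 0 := by rwa [h.volCoeff_eq]
  rw [funext (normedMetric_eq_sum b)]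
  refine DifferentiableAt.fun_sum fun i _ => ?_
  refine DifferentiableAt.fun_sum fun j _ => ?_
  have hg : DifferentiableAt ℝ (fun η => (volCoeff b η)⁻¹ * Bmat b η i j) φ :=
    (hvol.inv hvne).mul (differentiable_Bmat b i j φ)
  exact hg.smul_const _

/-- A map into `k`-forms is differentiable if its values on tuples of vectors are. -/
theorem differentiableAt_of_apply (b : Basis (Fin 7) ℝ E) {k : ℕ} {F : Type*}
    [NormedAddCommGroup F] [NormedSpace ℝ F] {ζ : F → E [⋀^Fin k]→L[ℝ] ℝ} {y : F}
    (h : ∀ v : Fin k → E, DifferentiableAt ℝ (fun z => ζ z v) y) : DifferentiableAt ℝ ζ y := by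
  let ev : (E [⋀^Fin k]→L[ℝ] ℝ) →ₗ[ℝ] (Fin k → Fin 7) → ℝ :=
    { toFun := fun η f => η fun a => b (f a)
      map_add' := fun _ _ => rfl
      map_smul' := fun _ _ => rfl }
  have hker : LinearMap.ker ev = ⊥ := by
    refine LinearMap.ker_eq_bot'.2 fun η hη => ?_
    have : η.toAlternatingMap = 0 := Basis.ext_alternating b fun f _ => congrFun hη f
    ext v
    exact congrArg (fun F => F v) this
  -- Evaluation on basis tuples is injective into a finite-dimensional space, so a linear left
  -- inverse recovers `ζ` from its components.
  obtain ⟨g, hg⟩ := LinearMap.exists_leftInverse_of_injective ev hker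
  have hζ : ζ = fun z => LinearMap.toContinuousLinearMap g (ev (ζ z)) := by
    funext z
    exact (LinearMap.congr_fun hg (ζ z)).symm
  rw [hζ]
  refine (ContinuousLinearMap.differentiableAt _).comp y ?_
  exact differentiableAt_pi.2 fun f => h _

/-- Naturality of adapted bases. -/
theorem IsAdapted.comp {V V' : Type*} [AddCommGroup V] [Module ℝ V] [TopologicalSpace V]
    [AddCommGroup V'] [Module ℝ V'] [TopologicalSpace V'] {e : Basis (Fin 7) ℝ V}
    {φ : V [⋀^Fin 3]→L[ℝ] ℝ} (h : IsAdapted e φ) (D : V' ≃L[ℝ] V) :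
    IsAdapted (e.map D.symm.toLinearEquiv)
      (φ.compContinuousLinearMap (D : V' →L[ℝ] V)) := by
  intro i j k
  rw [← h i j k]
  change φ _ = φ _
  congr 1
  ext a
  fin_cases a <;> exact D.apply_symm_apply _

/-- Naturality of the metric. -/
theorem IsAdapted.metric_comp {V V' : Type*} [AddCommGroup V] [Module ℝ V] [TopologicalSpace V]
    [AddCommGroup V'] [Module ℝ V'] [TopologicalSpace V'] [IsTopologicalAddGroup V]
    [ContinuousSMul ℝ V] [T2Space V] [IsTopologicalAddGroup V'] [ContinuousSMul ℝ V'] [T2Space V']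
    {e : Basis (Fin 7) ℝ V} {φ : V [⋀^Fin 3]→L[ℝ] ℝ} (h : IsAdapted e φ) (D : V' ≃L[ℝ] V)
    (b : Basis (Fin 7) ℝ V) (b' : Basis (Fin 7) ℝ V') (u v : V') :
    metric b' (φ.compContinuousLinearMap (D : V' →L[ℝ] V)) u v = metric b φ (D u) (D v) := by
  rw [(h.comp D).metric_apply, h.metric_apply]
  rfl

theorem derivAction_eq_fderivComp (A : E →L[ℝ] E) (η : E [⋀^Fin 3]→L[ℝ] ℝ) :
    η.fderivCompContinuousLinearMap (ContinuousLinearMap.id ℝ E) A = derivAction A η := by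
  ext v
  rw [ContinuousAlternatingMap.fderivCompContinuousLinearMap_apply, derivAction_apply]
  refine Finset.sum_congr rfl fun i _ => ?_
  congr 1
  ext j
  by_cases hj : j = i
  · subst hj; simp
  · simp [hj]

/-- The derivative of the metric of a positive form in the direction `A · φ`. -/
theorem IsAdapted.fderiv_metric_derivAction (h : IsAdapted e φ) (b : Basis (Fin 7) ℝ E)
    (A : E →L[ℝ] E) (u v : E) :
    fderiv ℝ (normedMetric b) φ (derivAction A φ) u v =
      metric b φ (A u) v + metric b φ u (A v) := by
  have : FiniteDimensional ℝ E := Module.Finite.of_basis e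
  have : CompleteSpace E := FiniteDimensional.complete ℝ E
  -- The curve of pull-backs of `φ` by `1 + tA` has velocity `A · φ` at `0`. Near `0` the map `1 +
  -- tA` is invertible and naturality gives the metric along the curve; the two computations of its
  -- derivative are then compared.
  let T : ℝ → E →L[ℝ] E := fun t => ContinuousLinearMap.id ℝ E + t • A
  have hT : HasDerivAt T A 0 := by
    have := ((hasDerivAt_id (0 : ℝ)).smul_const A).const_add (ContinuousLinearMap.id ℝ E)
    rwa [one_smul] at this
  have hT0 : T 0 = ContinuousLinearMap.id ℝ E := by simp [T]
  have hc : HasDerivAt (fun t => φ.compContinuousLinearMap (T t)) (derivAction A φ) 0 := by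
    have := (hasFDerivAt_const φ (0 : ℝ)).continuousAlternatingMapCompContinuousLinearMap
      hT.hasFDerivAt
    have h' := this.hasDerivAt
    rw [hT0] at h'
    convert! h' using 1
    simp [derivAction_eq_fderivComp]
  have hc0 : φ.compContinuousLinearMap (T 0) = φ := by rw [hT0]; rfl
  have hG : HasFDerivAt (normedMetric b) (fderiv ℝ (normedMetric b) φ)
      (φ.compContinuousLinearMap (T 0)) := by
    rw [hc0]; exact (h.differentiableAt_metric b).hasFDerivAt
  have h1 : HasDerivAt (fun t => normedMetric b (φ.compContinuousLinearMap (T t)))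
      (fderiv ℝ (normedMetric b) φ (derivAction A φ)) 0 := hG.comp_hasDerivAt (0 : ℝ) hc
  have h2 : HasDerivAt (fun t => normedMetric b (φ.compContinuousLinearMap (T t)) u v)
      (fderiv ℝ (normedMetric b) φ (derivAction A φ) u v) 0 :=
    (h1.clm_apply (hasDerivAt_const 0 u)).clm_apply (hasDerivAt_const 0 v) |>.congr_deriv
      (by simp)
  have hev : (fun t => normedMetric b (φ.compContinuousLinearMap (T t)) u v) =ᶠ[𝓝 0]
      fun t => normedMetric b φ (T t u) (T t v) := by
    have hn := ContinuousLinearEquiv.nhds (ContinuousLinearEquiv.refl ℝ E)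
    have hTc : Tendsto T (𝓝 0) (𝓝 ((ContinuousLinearEquiv.refl ℝ E : E ≃L[ℝ] E) : E →L[ℝ] E)) := by
      have := hT.continuousAt.tendsto
      rwa [hT0] at this
    filter_upwards [hTc hn] with t ht
    obtain ⟨D, hD⟩ := ht
    rw [← hD]
    exact h.metric_comp D b b u v
  have h3 : HasDerivAt (fun t => normedMetric b φ (T t u) (T t v))
      (normedMetric b φ (A u) v + normedMetric b φ u (A v)) 0 := by
    have hu : HasDerivAt (fun t => T t u) (A u) 0 :=
      (hT.clm_apply (hasDerivAt_const 0 u)).congr_deriv (by simp)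
    have hv : HasDerivAt (fun t => T t v) (A v) 0 :=
      (hT.clm_apply (hasDerivAt_const 0 v)).congr_deriv (by simp)
    have := ((normedMetric b φ).hasFDerivAt.comp_hasDerivAt (0 : ℝ) hu).clm_apply hv
    refine this.congr_deriv ?_
    simp [hT0]
  exact h2.unique (h3.congr_of_eventuallyEq hev)

end Calculus

end G2

end

noncomputable section

set_option maxSynthPendingDepth 3

namespace G2

/-! ### Lie derivatives of a closed positive form and of its metric on a vector space. -/

section LieDerivative

open Module Filter Topology

variable {E : Type*} [NormedAddCommGroup E] [NormedSpace ℝ E]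

/-- The Lie derivative of a `3`-form on a vector space. -/
def flatLie (X : E → E) (φ : E → E [⋀^Fin 3]→L[ℝ] ℝ) (y : E) : E [⋀^Fin 3]→L[ℝ] ℝ :=
  fderiv ℝ φ y (X y) + derivAction (fderiv ℝ X y) (φ y)

variable {X : E → E} {φ : E → E [⋀^Fin 3]→L[ℝ] ℝ} {y : E}

theorem extDeriv_vec4 (φ : E → E [⋀^Fin 3]→L[ℝ] ℝ) (y a b c d : E) :
    extDeriv φ y ![a, b, c, d] = fderiv ℝ φ y a ![b, c, d] - fderiv ℝ φ y b ![a, c, d] +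
      fderiv ℝ φ y c ![a, b, d] - fderiv ℝ φ y d ![a, b, c] :=
  (ContinuousAlternatingMap.alternatizeUncurryFin_apply _ _).trans
    (altSum_vec4 (fun u v => fderiv ℝ φ y u v) a b c d)

theorem extDeriv_vec6 (φ : E → E [⋀^Fin 5]→L[ℝ] ℝ) (y a b c d e f : E) :
    extDeriv φ y ![a, b, c, d, e, f] =
      fderiv ℝ φ y a ![b, c, d, e, f] - fderiv ℝ φ y b ![a, c, d, e, f] +
      fderiv ℝ φ y c ![a, b, d, e, f] - fderiv ℝ φ y d ![a, b, c, e, f] +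
      fderiv ℝ φ y e ![a, b, c, d, f] - fderiv ℝ φ y f ![a, b, c, d, e] :=
  (ContinuousAlternatingMap.alternatizeUncurryFin_apply _ _).trans
    (altSum_vec6 (fun u v => fderiv ℝ φ y u v) a b c d e f)

/-- The derivative of the components of `X ⌟ φ`. -/
def contractDeriv (X : E → E) (φ : E → E [⋀^Fin 3]→L[ℝ] ℝ) (y v p q : E) : ℝ :=
  fderiv ℝ φ y v ![X y, p, q] + φ y ![fderiv ℝ X y v, p, q]

/-- Cartan's formula `L_X φ = d(X ⌟ φ)` for a closed `3`-form. -/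
theorem flatLie_apply_of_closed (hd : extDeriv φ y = 0) (a b c : E) :
    flatLie X φ y ![a, b, c] =
      contractDeriv X φ y a b c - contractDeriv X φ y b a c + contractDeriv X φ y c a b := by
  have h4 := extDeriv_vec4 φ y (X y) a b c
  rw [hd] at h4
  change 0 = _ at h4
  rw [flatLie, ContinuousAlternatingMap.add_apply, derivAction_vec3]
  simp only [contractDeriv]
  rw [form3_swap₁₂ (φ y) a (fderiv ℝ X y b) c, form3_swap₂₃ (φ y) a b (fderiv ℝ X y c),
    form3_swap₁₂ (φ y) a (fderiv ℝ X y c) b]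
  linarith

theorem hasFDerivAt_contract (hφ : DifferentiableAt ℝ φ y) (hX : DifferentiableAt ℝ X y)
    (p q : E) : ∃ L : E →L[ℝ] ℝ, HasFDerivAt (fun z => φ z ![X z, p, q]) L y ∧
      ∀ v, L v = contractDeriv X φ y v p q := by
  let g : Fin 3 → E → E := ![X, fun _ => p, fun _ => q]
  have hg : ∀ i, DifferentiableAt ℝ (g i) y := by
    intro i
    fin_cases i
    · exact hX
    · exact differentiableAt_const p
    · exact differentiableAt_const q
  have heq : (fun z => φ z ![X z, p, q]) = fun z => φ z (g · z) := by
    funext z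
    congr 1
    ext i; fin_cases i <;> rfl
  rw [heq]
  refine ⟨_, hφ.hasFDerivAt.continuousAlternatingMap_apply fun i => (hg i).hasFDerivAt, ?_⟩
  intro v
  have h0 : fderiv ℝ (g 0) y = fderiv ℝ X y := rfl
  have h1 : fderiv ℝ (g 1) y = 0 := fderiv_const_apply p
  have h2 : fderiv ℝ (g 2) y = 0 := fderiv_const_apply q
  have hvec : (fun i => g i y) = ![X y, p, q] := by
    ext i; fin_cases i <;> rfl
  have hup : Function.update ![X y, p, q] 0 (fderiv ℝ X y v) = ![fderiv ℝ X y v, p, q] := by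
    ext i; fin_cases i <;> rfl
  simp [Fin.sum_univ_three, h0, h1, h2, hvec, hup, contractDeriv]

/-- The components of a product of a `2`-form and a `3`-form obey the product rule. -/
theorem hasFDerivAt_shuffle23 {ι : Type*} {α : ι → ι → E → ℝ} {β : ι → ι → ι → E → ℝ}
    {α' : ι → ι → E →L[ℝ] ℝ} {β' : ι → ι → ι → E →L[ℝ] ℝ}
    (hα : ∀ p q, HasFDerivAt (α p q) (α' p q) y)
    (hβ : ∀ p q r, HasFDerivAt (β p q r) (β' p q r) y) (a b c d e : ι) :
    ∃ L : E →L[ℝ] ℝ, HasFDerivAt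
      (fun z => shuffle23 (fun p q => α p q z) (fun p q r => β p q r z) a b c d e) L y ∧
      ∀ v, L v = shuffle23 (fun p q => α' p q v) (fun p q r => β p q r y) a b c d e +
        shuffle23 (fun p q => α p q y) (fun p q r => β' p q r v) a b c d e := by
  have h (p q r s t : ι) := (hα p q).fun_mul (hβ r s t)
  refine ⟨_, (((((((((h a b c d e).fun_sub (h a c b d e)).fun_add (h a d b c e)).fun_sub
    (h a e b c d)).fun_add (h b c a d e)).fun_sub (h b d a c e)).fun_add (h b e a c d)).fun_add
    (h c d a b e)).fun_sub (h c e a b d)).fun_add (h d e a b c), fun v => ?_⟩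
  simp only [shuffle23, add_apply, sub_apply, smul_apply, smul_eq_mul]
  ring

/-- For a positive form that is closed at `y`, `d*(X ⌟ φ) = ½ (L_X φ) ∧ φ` at `y`. -/
theorem extDeriv_star_contract (b : Basis (Fin 7) ℝ E) (hφ : DifferentiableAt ℝ φ y)
    (hX : DifferentiableAt ℝ X y)
    (hpos : ∀ᶠ z in 𝓝 y, ∃ e : Basis (Fin 7) ℝ E, IsAdapted e (φ z)) (hd : extDeriv φ y = 0)
    (v₀ v₁ v₂ v₃ v₄ v₅ : E) :
    extDeriv (fun z => star b (φ z) 2 5 rfl (contract (X z) (φ z))) y ![v₀, v₁, v₂, v₃, v₄, v₅] =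
      (1 / 2) * shuffle33 (fun p q r => flatLie X φ y ![p, q, r]) (fun p q r => φ y ![p, q, r])
        v₀ v₁ v₂ v₃ v₄ v₅ := by
  set S := fun z => star b (φ z) 2 5 rfl (contract (X z) (φ z))
  choose α' hα hα' using fun p q => hasFDerivAt_contract hφ hX p q
  have hβ (p q r : E) : HasFDerivAt (fun z => φ z ![p, q, r])
      ((ContinuousAlternatingMap.apply ℝ E ℝ ![p, q, r]).comp (fderiv ℝ φ y)) y :=
    (ContinuousAlternatingMap.apply ℝ E ℝ ![p, q, r]).hasFDerivAt.comp y hφ.hasFDerivAt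
  have hderiv (a b c d e : E) : ∃ L : E →L[ℝ] ℝ,
      HasFDerivAt (fun z => S z ![a, b, c, d, e]) L y ∧ ∀ v, L v = (1 / 2) *
        (shuffle23 (contractDeriv X φ y v) (fun p q r => φ y ![p, q, r]) a b c d e +
        shuffle23 (fun p q => φ y ![X y, p, q]) (fun p q r => fderiv ℝ φ y v ![p, q, r])
          a b c d e) := by
    obtain ⟨L, hL, hLv⟩ := hasFDerivAt_shuffle23 hα hβ a b c d e
    refine ⟨(1 / 2 : ℝ) • L, (hL.const_mul (1 / 2 : ℝ)).congr_of_eventuallyEq ?_, fun v => ?_⟩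
    -- The formula for the star is differentiated, so positivity is needed on a neighbourhood,
    -- whereas closedness is used only at `y`.
    · filter_upwards [hpos] with z hz
      obtain ⟨e', he'⟩ := hz
      exact he'.star_contract _ _ _ _ _ _ _
    · rw [smul_apply, hLv, smul_eq_mul]
      simp only [hα']
      rfl
  clear_value S
  have hdiff : DifferentiableAt ℝ S y := by
    refine differentiableAt_of_apply b fun v => ?_
    obtain ⟨v₀, v₁, v₂, v₃, v₄, rfl⟩ : ∃ a b c d e : E, v = ![a, b, c, d, e] :=
      ⟨v 0, v 1, v 2, v 3, v 4, by funext i; fin_cases i <;> rfl⟩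
    obtain ⟨L, hL, -⟩ := hderiv v₀ v₁ v₂ v₃ v₄
    exact hL.differentiableAt
  have happ (w a b c d e : E) : fderiv ℝ S y w ![a, b, c, d, e] = (1 / 2) *
        (shuffle23 (contractDeriv X φ y w) (fun p q r => φ y ![p, q, r]) a b c d e +
        shuffle23 (fun p q => φ y ![X y, p, q]) (fun p q r => fderiv ℝ φ y w ![p, q, r])
          a b c d e) := by
    obtain ⟨L, hL, hLv⟩ := hderiv a b c d e
    rw [← fderiv_continuousAlternatingMap_apply_const_apply hdiff, hL.fderiv, hLv]
  have hclosed (p q r s : E) : fderiv ℝ φ y p ![q, r, s] - fderiv ℝ φ y q ![p, r, s] +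
      fderiv ℝ φ y r ![p, q, s] - fderiv ℝ φ y s ![p, q, r] = 0 := by
    rw [← extDeriv_vec4, hd]
    rfl
  rw [extDeriv_vec6]
  simp only [happ, flatLie_apply_of_closed hd]
  rw [← shuffle23_leibniz (fun p q => φ y ![X y, p, q]) (fun p q r => φ y ![p, q, r])
    (contractDeriv X φ y) (fun v p q r => fderiv ℝ φ y v ![p, q, r]) hclosed]
  ring

/-- The Lie derivative of the metric of a positive form is the image of the Lie derivative of the
form under the derivative of the metric. -/
theorem flatLie_metric (b e : Basis (Fin 7) ℝ E) (he : IsAdapted e (φ y))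
    (hφ : DifferentiableAt ℝ φ y) (u v : E) :
    fderiv ℝ (fun z => normedMetric b (φ z)) y (X y) u v +
        normedMetric b (φ y) (fderiv ℝ X y u) v + normedMetric b (φ y) u (fderiv ℝ X y v) =
      fderiv ℝ (normedMetric b) (φ y) (flatLie X φ y) u v := by
  have h1 : fderiv ℝ (fun z => normedMetric b (φ z)) y =
      (fderiv ℝ (normedMetric b) (φ y)).comp (fderiv ℝ φ y) :=
    ((he.differentiableAt_metric b).hasFDerivAt.comp y hφ.hasFDerivAt).fderiv
  have h2 := he.fderiv_metric_derivAction b (fderiv ℝ X y) u v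
  rw [h1, flatLie, map_add]
  simp only [add_apply, h2, ContinuousLinearMap.comp_apply]
  rw [add_assoc]
  rfl

end LieDerivative

end G2

end

noncomputable section

set_option maxSynthPendingDepth 3

namespace G2

/-! ### Naturality of the star, and the decomposition on a vector space. -/

section Core

open Module Filter Topology

section Naturality

variable {V V' : Type*} [AddCommGroup V] [Module ℝ V] [TopologicalSpace V]
  [AddCommGroup V'] [Module ℝ V'] [TopologicalSpace V']

theorem insertVecs_comp {q p : ℕ} (D : V' →L[ℝ] V) (v : Fin p → V')
    (η : V [⋀^Fin (q + p)]→L[ℝ] ℝ) (w : Fin q → V') :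
    insertVecs p v (η.compContinuousLinearMap D) w =
      insertVecs p (fun a => D (v a)) η (fun a => D (w a)) := by
  induction p with
  | zero => rfl
  | succ p ih =>
    have hc : contract (n := q + p) (v 0) (η.compContinuousLinearMap D) =
        (contract (n := q + p) (D (v 0)) η).compContinuousLinearMap D := by
      ext u
      change η _ = η _
      congr 1
      ext a
      refine Fin.cases ?_ (fun a => ?_) a <;> rfl
    change insertVecs p (Fin.tail v) (contract (n := q + p) (v 0)
      (η.compContinuousLinearMap D)) w = _
    rw [hc, ih]
    rfl

theorem contract_comp {n : ℕ} (D : V' →L[ℝ] V) (v : V') (η : V [⋀^Fin (n + 1)]→L[ℝ] ℝ) :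
    contract v (η.compContinuousLinearMap D) = (contract (D v) η).compContinuousLinearMap D := by
  ext u
  change η _ = η _
  congr 1
  ext a
  refine Fin.cases ?_ (fun a => ?_) a <;> rfl

theorem cast_compContinuousLinearMap {m n : ℕ} (h : m = n) (D : V' →L[ℝ] V)
    (η : V [⋀^Fin n]→L[ℝ] ℝ) :
    (h ▸ η.compContinuousLinearMap D : V' [⋀^Fin m]→L[ℝ] ℝ) =
      (h ▸ η : V [⋀^Fin m]→L[ℝ] ℝ).compContinuousLinearMap D := by
  subst h; rfl

/-- Naturality of the Hodge star. -/
theorem IsAdapted.star_comp [IsTopologicalAddGroup V] [ContinuousSMul ℝ V] [T2Space V]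
    [IsTopologicalAddGroup V'] [ContinuousSMul ℝ V'] [T2Space V']
    {e : Basis (Fin 7) ℝ V} {φ : V [⋀^Fin 3]→L[ℝ] ℝ} (h : IsAdapted e φ) (D : V' ≃L[ℝ] V)
    (b : Basis (Fin 7) ℝ V) (b' : Basis (Fin 7) ℝ V') {p q : ℕ} (hpq : q + p = 7)
    (α : V [⋀^Fin p]→L[ℝ] ℝ) :
    star b' (φ.compContinuousLinearMap (D : V' →L[ℝ] V)) p q hpq
        (α.compContinuousLinearMap (D : V' →L[ℝ] V)) =
      (star b φ p q hpq α).compContinuousLinearMap (D : V' →L[ℝ] V) := by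
  have hvol : vol b' (φ.compContinuousLinearMap (D : V' →L[ℝ] V)) =
      (vol b φ).compContinuousLinearMap (D : V' →L[ℝ] V) := by
    ext w
    rw [(h.comp D).vol_apply]
    exact (h.vol_apply b _).symm
  ext w
  refine ((h.comp D).star_apply b' hpq _ w).trans (Eq.trans ?_ (h.star_apply b hpq α _).symm)
  rw [hvol, cast_compContinuousLinearMap hpq]
  have hD (k : Fin 7) : (D : V' →L[ℝ] V) (e.map D.symm.toLinearEquiv k) = e k :=
    D.apply_symm_apply _
  congr 1
  refine Finset.sum_congr rfl fun k _ => ?_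
  rw [insertVecs_comp]
  simp only [hD]
  congr 1
  change α (fun a => (D : V' →L[ℝ] V) (e.map D.symm.toLinearEquiv (k a))) = _
  simp only [hD]

theorem IsAdapted.star_contract_comp [IsTopologicalAddGroup V] [ContinuousSMul ℝ V] [T2Space V]
    [IsTopologicalAddGroup V'] [ContinuousSMul ℝ V'] [T2Space V']
    {e : Basis (Fin 7) ℝ V} {φ : V [⋀^Fin 3]→L[ℝ] ℝ} (h : IsAdapted e φ) (D : V' ≃L[ℝ] V)
    (b : Basis (Fin 7) ℝ V) (b' : Basis (Fin 7) ℝ V') {v : V} {v' : V'} (hv : D v' = v) :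
    star b' (φ.compContinuousLinearMap (D : V' →L[ℝ] V)) 2 5 rfl
        (contract v' (φ.compContinuousLinearMap (D : V' →L[ℝ] V))) =
      (star b φ 2 5 rfl (contract v φ)).compContinuousLinearMap (D : V' →L[ℝ] V) := by
  subst hv
  rw [contract_comp]
  exact h.star_comp D b b' rfl _

end Naturality

variable {E : Type*} [NormedAddCommGroup E] [NormedSpace ℝ E]
  {X : E → E} {φ : E → E [⋀^Fin 3]→L[ℝ] ℝ} {y : E}

/-- The codifferential of `X ⌟ φ` in an adapted basis. -/
theorem star_extDeriv_basis (b : Basis (Fin 7) ℝ E) {e : Basis (Fin 7) ℝ E}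
    (he : IsAdapted e (φ y)) (hφ : DifferentiableAt ℝ φ y) (hX : DifferentiableAt ℝ X y)
    (hpos : ∀ᶠ z in 𝓝 y, ∃ e : Basis (Fin 7) ℝ E, IsAdapted e (φ z)) (hd : extDeriv φ y = 0)
    {S : E → E [⋀^Fin 5]→L[ℝ] ℝ}
    (hS : S =ᶠ[𝓝 y] fun z => star b (φ z) 2 5 rfl (contract (X z) (φ z))) (l : Fin 7) :
    star b (φ y) 6 1 rfl (extDeriv S y) ![e l] = (1 / 2) * ((-1) ^ l.val * shuffle33
      (fun p q r => flatLie X φ y ![p, q, r]) (fun p q r => φ y ![p, q, r])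
      (e (l.succAbove 0)) (e (l.succAbove 1)) (e (l.succAbove 2)) (e (l.succAbove 3))
      (e (l.succAbove 4)) (e (l.succAbove 5))) := by
  have hw : (fun a => e (l.succAbove a)) = ![e (l.succAbove 0), e (l.succAbove 1),
      e (l.succAbove 2), e (l.succAbove 3), e (l.succAbove 4), e (l.succAbove 5)] := by
    funext a; fin_cases a <;> rfl
  have hE : extDeriv S y =
      extDeriv (fun z => star b (φ z) 2 5 rfl (contract (X z) (φ z))) y := by
    rw [extDeriv, extDeriv, hS.fderiv_eq]
  rw [he.star_six_one, hw, hE, extDeriv_star_contract b hφ hX hpos hd]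
  ring

/-- The decomposition of the Lie derivative of a positive `3`-form, closed at `y`. -/
theorem flatLie_eq (b : Basis (Fin 7) ℝ E) {e : Basis (Fin 7) ℝ E}
    (he : IsAdapted e (φ y)) (hφ : DifferentiableAt ℝ φ y) (hX : DifferentiableAt ℝ X y)
    (hpos : ∀ᶠ z in 𝓝 y, ∃ e : Basis (Fin 7) ℝ E, IsAdapted e (φ z)) (hd : extDeriv φ y = 0)
    {S : E → E [⋀^Fin 5]→L[ℝ] ℝ}
    (hS : S =ᶠ[𝓝 y] fun z => star b (φ z) 2 5 rfl (contract (X z) (φ z)))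
    {s : E →L[ℝ] E →L[ℝ] ℝ}
    (hs : ∀ u v, s u v = fderiv ℝ (normedMetric b) (φ y) (flatLie X φ y) u v)
    {η : E [⋀^Fin 3]→L[ℝ] ℝ} (hη : φ y = η) {θ : E [⋀^Fin 1]→L[ℝ] ℝ}
    (hθS : θ = star b (φ y) 6 1 rfl (extDeriv S y)) :
    flatLie X φ y = (1 / 2 : ℝ) • iPhi b η s + (1 / 2 : ℝ) •
      contract (sharp b η θ) (psi b η) := by
  subst hη
  subst hθS
  -- The endomorphism is unique only up to the stabiliser algebra `g₂`; any choice serves, since `s`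
  -- and `θ` depend on `A · φ` alone.
  obtain ⟨A, hA⟩ := he.exists_derivAction_eq (flatLie X φ y)
  have hθ := star_extDeriv_basis b he hφ hX hpos hd hS
  rw [hA] at hs hθ ⊢
  refine he.derivAction_eq b A s (fun u v => ?_) _ hθ
  rw [hs, he.fderiv_metric_derivAction]

theorem oneForm_eq_zero (e : Basis (Fin 7) ℝ E) (θ : E [⋀^Fin 1]→L[ℝ] ℝ)
    (h : ∀ l, θ ![e l] = 0) : θ = 0 := by
  have key : θ.toAlternatingMap = 0 := by
    refine Basis.ext_alternating e fun f _ => ?_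
    have hf : (fun a => e (f a)) = ![e (f 0)] := by
      funext a; fin_cases a; rfl
    rw [hf]
    exact h (f 0)
  ext v
  exact congrArg (fun F => F v) key

theorem shuffle33_zero_left (g : E → E → E → ℝ) (u₀ u₁ u₂ u₃ u₄ u₅ : E) (c : ℝ) :
    (1 / 2) * (c * shuffle33 (fun p q r => (0 : E [⋀^Fin 3]→L[ℝ] ℝ) ![p, q, r]) g
      u₀ u₁ u₂ u₃ u₄ u₅) = 0 := by
  have hz (p q r : E) : (0 : E [⋀^Fin 3]→L[ℝ] ℝ) ![p, q, r] = 0 := rfl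
  simp only [shuffle33, hz]
  ring

/-- The codifferential is linear in the Lie derivative, so no injectivity of the decomposition is
needed. -/
theorem star_extDeriv_eq_zero (b : Basis (Fin 7) ℝ E) {e : Basis (Fin 7) ℝ E}
    (he : IsAdapted e (φ y)) (hφ : DifferentiableAt ℝ φ y) (hX : DifferentiableAt ℝ X y)
    (hpos : ∀ᶠ z in 𝓝 y, ∃ e : Basis (Fin 7) ℝ E, IsAdapted e (φ z)) (hd : extDeriv φ y = 0)
    {S : E → E [⋀^Fin 5]→L[ℝ] ℝ}
    (hS : S =ᶠ[𝓝 y] fun z => star b (φ z) 2 5 rfl (contract (X z) (φ z)))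
    (h0 : flatLie X φ y = 0) : star b (φ y) 6 1 rfl (extDeriv S y) = 0 := by
  refine oneForm_eq_zero e _ fun l => (star_extDeriv_basis b he hφ hX hpos hd hS l).trans ?_
  rw [h0]
  exact shuffle33_zero_left _ _ _ _ _ _ _ _

end Core

end G2

end

noncomputable section

set_option maxSynthPendingDepth 3

namespace G2

/-! ### Passage from the manifold to the preferred chart. -/

section Charts

open Module Filter Topology

variable {M : Type*} [TopologicalSpace M] [ChartedSpace E7 M]

/-- The standard basis of `ℝ⁷`. -/
abbrev stdBasis : Basis (Fin 7) ℝ E7 := (EuclideanSpace.basisFun (Fin 7) ℝ).toBasis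

theorem isInvertible_mfderiv_chartInv [IsManifold (𝓡 7) 1 M] (x : M) {y : E7}
    (hy : y ∈ (extChartAt (𝓡 7) x).target) :
    (mfderiv 𝓘(ℝ, E7) (𝓡 7) (chartInv x) y).IsInvertible := by
  have h := isInvertible_mfderivWithin_extChartAt_symm (I := 𝓡 7) hy
  rwa [ModelWithCorners.range_eq_univ, mfderivWithin_univ] at h

theorem mfderiv_chartInv_self [IsManifold (𝓡 7) 1 M] (x : M) :
    mfderiv 𝓘(ℝ, E7) (𝓡 7) (chartInv x) (extChartAt (𝓡 7) x x) =
      (ContinuousLinearMap.id ℝ E7 : E7 →L[ℝ] E7) := by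
  have h := mfderivWithin_range_extChartAt_symm (I := 𝓡 7) (x := x)
  rw [ModelWithCorners.range_eq_univ, mfderivWithin_univ] at h
  exact h

theorem Form.inChart_self [IsManifold (𝓡 7) 1 M] {k : ℕ} (η : Form M k) (x : M) :
    η.inChart x (extChartAt (𝓡 7) x x) = (η x : E7 [⋀^Fin k]→L[ℝ] ℝ) := by
  -- The base point occurs in the type of the form; generalising it together with the differential
  -- allows both to be substituted.
  have key : ∀ (q : M) (D : E7 →L[ℝ] E7), q = x → D = ContinuousLinearMap.id ℝ E7 →
      ((η q : E7 [⋀^Fin k]→L[ℝ] ℝ).compContinuousLinearMap D : E7 [⋀^Fin k]→L[ℝ] ℝ) =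
        (η x : E7 [⋀^Fin k]→L[ℝ] ℝ) := by
    rintro q D rfl rfl
    rfl
  exact key _ _ (extChartAt_to_inv x) (mfderiv_chartInv_self x)

variable {φ : Form M 3} {X : VField M}

theorem IsG2Structure.exists_isAdapted_inChart [IsManifold (𝓡 7) 1 M] (hφ : IsG2Structure φ)
    (x : M) {y : E7} (hy : y ∈ (extChartAt (𝓡 7) x).target) :
    ∃ e : Basis (Fin 7) ℝ E7, IsAdapted e (φ.inChart x y) := by
  obtain ⟨D, hD⟩ := isInvertible_mfderiv_chartInv x hy
  obtain ⟨e, he⟩ := exists_isAdapted (hφ.positive (chartInv x y))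
  refine ⟨e.map D.symm.toLinearEquiv, ?_⟩
  rw [Form.inChart, ← hD]
  exact he.comp D

/-- At a nearby point the tangent basis comes from another preferred chart and need not correspond
to `stdBasis`. The metric does not depend on the basis, so naturality under the chart differential
suffices. -/
theorem IsG2Structure.assocMetric_inChart [IsManifold (𝓡 7) 1 M] (hφ : IsG2Structure φ)
    (x : M) {y : E7} (hy : y ∈ (extChartAt (𝓡 7) x).target) :
    (assocMetric φ).inChart x y = normedMetric stdBasis (φ.inChart x y) := by
  obtain ⟨D, hD⟩ := isInvertible_mfderiv_chartInv x hy
  obtain ⟨e, he⟩ := exists_isAdapted (hφ.positive (chartInv x y))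
  rw [Form.inChart, Tensor2.inChart, ← hD]
  ext u v
  exact (he.metric_comp D (tangentBasis _) stdBasis u v).symm

/-- The star commutes with the chart differential because the latter is invertible throughout the
chart target. -/
theorem IsG2Structure.hodge_contract_inChart [IsManifold (𝓡 7) 1 M] (hφ : IsG2Structure φ)
    (X : VField M) (x : M) {y : E7} (hy : y ∈ (extChartAt (𝓡 7) x).target) :
    (hodge φ 2 5 rfl (Form.contract X φ)).inChart x y =
      star stdBasis (φ.inChart x y) 2 5 rfl (contract (X.inChart x y) (φ.inChart x y)) := by
  obtain ⟨D, hD⟩ := isInvertible_mfderiv_chartInv x hy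
  obtain ⟨e, he⟩ := exists_isAdapted (hφ.positive (chartInv x y))
  have hX : D (X.inChart x y) = X (chartInv x y) := by
    rw [VField.inChart, VectorField.mpullback_apply, ← hD, ContinuousLinearMap.inverse_equiv]
    exact D.apply_symm_apply _
  rw [Form.inChart, Form.inChart, ← hD]
  exact (he.star_contract_comp D (tangentBasis _) stdBasis hX).symm

theorem IsG2Structure.hodge_contract_inChart_eventuallyEq [IsManifold (𝓡 7) 1 M]
    (hφ : IsG2Structure φ) (X : VField M) (x : M) :
    (hodge φ 2 5 rfl (Form.contract X φ)).inChart x =ᶠ[𝓝 (extChartAt (𝓡 7) x x)]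
      fun z => star stdBasis (φ.inChart x z) 2 5 rfl
        (contract (X.inChart x z) (φ.inChart x z)) :=
  Filter.eventually_of_mem (extChartAt_target_mem_nhds x)
    fun _ hz => hφ.hodge_contract_inChart X x hz

theorem IsG2Structure.differentiableAt_inChart (hφ : IsG2Structure φ) (x : M) :
    DifferentiableAt ℝ (φ.inChart x) (extChartAt (𝓡 7) x x) :=
  ((hφ.smooth x).contDiffAt (extChartAt_target_mem_nhds x)).differentiableAt (by simp)

theorem VField.IsSmooth.differentiableAt_inChart [IsManifold (𝓡 7) ∞ M] (hX : X.IsSmooth) (x : M) :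
    DifferentiableAt ℝ (X.inChart x) (extChartAt (𝓡 7) x x) := by
  have h1 : ContMDiffAt (𝓡 7) (𝓡 7).tangent 1
      (fun x => (⟨x, X x⟩ : TangentBundle (𝓡 7) M))
      (chartInv x (extChartAt (𝓡 7) x x)) := (hX _).of_le (by simp)
  -- Pulling back a vector field uses the derivative of the map, so a `C²` chart is needed for a
  -- `C¹` result.
  have h2 : ContMDiffAt 𝓘(ℝ, E7) (𝓡 7) 2 (chartInv x) (extChartAt (𝓡 7) x x) :=
    ((contMDiffOn_extChartAt_symm (n := ∞) x).contMDiffAt (extChartAt_target_mem_nhds x)).of_le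
      (WithTop.coe_le_coe.2 le_top)
  have : IsManifold (𝓡 7) 2 M := IsManifold.of_le (n := ∞) (WithTop.coe_le_coe.2 le_top)
  have h3 := h1.mpullback_vectorField_preimage h2
    (isInvertible_mfderiv_chartInv x (mem_extChartAt_target x)) (by norm_num)
  have h4 : ContDiffAt ℝ 1 (X.inChart x) (extChartAt (𝓡 7) x x) :=
    contMDiffAt_vectorSpace_iff_contDiffAt.1 h3
  exact h4.differentiableAt (by simp)

theorem compContinuousLinearMap_of_eq_id {k : ℕ} (η : E7 [⋀^Fin k]→L[ℝ] ℝ) {D : E7 →L[ℝ] E7}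
    (hD : D = ContinuousLinearMap.id ℝ E7) : η.compContinuousLinearMap D = η := by
  subst hD; rfl

theorem Form.lie_eq_flatLie [IsManifold (𝓡 7) 1 M] (X : VField M) (φ : Form M 3) (x : M) :
    (Form.lie X φ x : E7 [⋀^Fin 3]→L[ℝ] ℝ) =
      flatLie (X.inChart x) (φ.inChart x) (extChartAt (𝓡 7) x x) :=
  compContinuousLinearMap_of_eq_id _ mfderiv_extChartAt_self

theorem Form.d_eq_extDeriv [IsManifold (𝓡 7) 1 M] {k : ℕ} (η : Form M k) (x : M) :
    (η.d x : E7 [⋀^Fin (k + 1)]→L[ℝ] ℝ) = extDeriv (η.inChart x) (extChartAt (𝓡 7) x x) :=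
  compContinuousLinearMap_of_eq_id _ mfderiv_extChartAt_self

theorem pullbackBilin_of_eq_id (h : E7 →L[ℝ] E7 →L[ℝ] ℝ) {D : E7 →L[ℝ] E7}
    (hD : D = ContinuousLinearMap.id ℝ E7) (u v : E7) : pullbackBilin D h u v = h u v := by
  subst hD; rfl

/-- The chain rule and equivariance show that `L_X g` depends on `X` only through `L_X φ`. -/
theorem IsG2Structure.lie_assocMetric [IsManifold (𝓡 7) 1 M] (hφ : IsG2Structure φ)
    (X : VField M) (x : M) (u v : E7) :
    (Tensor2.lie X (assocMetric φ) x : E7 →L[ℝ] E7 →L[ℝ] ℝ) u v =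
      fderiv ℝ (normedMetric stdBasis) (φ.inChart x (extChartAt (𝓡 7) x x))
        (flatLie (X.inChart x) (φ.inChart x) (extChartAt (𝓡 7) x x)) u v := by
  obtain ⟨e, he⟩ := hφ.exists_isAdapted_inChart x (mem_extChartAt_target x)
  have h1 : (assocMetric φ).inChart x =ᶠ[𝓝 (extChartAt (𝓡 7) x x)]
      fun z => normedMetric stdBasis (φ.inChart x z) :=
    Filter.eventually_of_mem (extChartAt_target_mem_nhds x) fun z hz => hφ.assocMetric_inChart x hz
  rw [← flatLie_metric stdBasis e he (hφ.differentiableAt_inChart x), ← h1.fderiv_eq,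
    ← h1.eq_of_nhds]
  exact pullbackBilin_of_eq_id _ mfderiv_extChartAt_self u v

theorem codiff_apply [IsManifold (𝓡 7) 1 M] (φ : Form M 3) (β : Form M 2) (x : M) :
    (codiff φ β x : E7 [⋀^Fin 1]→L[ℝ] ℝ) =
      star stdBasis (φ.inChart x (extChartAt (𝓡 7) x x)) 6 1 rfl
        (extDeriv ((hodge φ 2 5 rfl β).inChart x) (extChartAt (𝓡 7) x x)) := by
  rw [Form.inChart_self, ← Form.d_eq_extDeriv]
  rfl

section Decomposition

variable [IsManifold (𝓡 7) ∞ M]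

set_option maxRecDepth 4000 in
theorem IsG2Structure.lie_apply (hφ : IsG2Structure φ) (hclosed : φ.d = 0) (hX : X.IsSmooth)
    (x : M) :
    Form.lie X φ x = (1 / 2 : ℝ) • iPhiForm φ (Tensor2.lie X (assocMetric φ)) x +
      (1 / 2 : ℝ) • Form.contract (sharpField φ (codiff φ (Form.contract X φ))) (psiForm φ) x := by
  obtain ⟨e, he⟩ := hφ.exists_isAdapted_inChart x (mem_extChartAt_target x)
  have hd : extDeriv (φ.inChart x) (extChartAt (𝓡 7) x x) = 0 :=
    (φ.d_eq_extDeriv x).symm.trans (congrFun hclosed x)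
  exact (Form.lie_eq_flatLie X φ x).trans <| flatLie_eq stdBasis he
    (hφ.differentiableAt_inChart x) (hX.differentiableAt_inChart x)
    (Filter.eventually_of_mem (extChartAt_target_mem_nhds x)
      fun z hz => hφ.exists_isAdapted_inChart x hz) hd
    (hφ.hodge_contract_inChart_eventuallyEq X x) (hφ.lie_assocMetric X x) (φ.inChart_self x)
    (codiff_apply φ (Form.contract X φ) x)

/-- Each conclusion is read from its own linear expression in `L_X φ`, not from the decomposition
formula. -/
theorem IsG2Structure.lie_eq_zero (hφ : IsG2Structure φ) (hclosed : φ.d = 0) (hX : X.IsSmooth)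
    (x : M) (h0 : Form.lie X φ x = 0) :
    Tensor2.lie X (assocMetric φ) x = 0 ∧ codiff φ (Form.contract X φ) x = 0 := by
  obtain ⟨e, he⟩ := hφ.exists_isAdapted_inChart x (mem_extChartAt_target x)
  have hd : extDeriv (φ.inChart x) (extChartAt (𝓡 7) x x) = 0 :=
    (φ.d_eq_extDeriv x).symm.trans (congrFun hclosed x)
  have hz : flatLie (X.inChart x) (φ.inChart x) (extChartAt (𝓡 7) x x) = 0 :=
    (Form.lie_eq_flatLie X φ x).symm.trans h0
  constructor
  · refine ContinuousLinearMap.ext fun u => ContinuousLinearMap.ext fun v => ?_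
    refine (hφ.lie_assocMetric X x u v).trans ?_
    rw [hz, map_zero]
    rfl
  · refine (codiff_apply φ _ x).trans ?_
    exact star_extDeriv_eq_zero stdBasis he (hφ.differentiableAt_inChart x)
      (hX.differentiableAt_inChart x)
      (Filter.eventually_of_mem (extChartAt_target_mem_nhds x)
        fun z hz => hφ.exists_isAdapted_inChart x hz) hd
      (hφ.hodge_contract_inChart_eventuallyEq X x) hz

end Decomposition

section Zero

variable {V : Type*} [AddCommGroup V] [Module ℝ V] [TopologicalSpace V]

theorem iPhi_zero [IsTopologicalAddGroup V] [ContinuousSMul ℝ V] (b : Basis (Fin 7) ℝ V)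
    (φ : V [⋀^Fin 3]→L[ℝ] ℝ) : iPhi b φ 0 = 0 := by
  have hr : raise b φ 0 = 0 := by
    ext v
    simp [raise]
  ext v
  rw [iPhi, hr, derivAction_apply]
  exact Finset.sum_eq_zero fun i _ => φ.map_coord_zero i (by simp)

theorem sharp_zero (b : Basis (Fin 7) ℝ V) (φ : V [⋀^Fin 3]→L[ℝ] ℝ) : sharp b φ 0 = 0 := by
  simp [sharp]

theorem contract_zero_left {n : ℕ} (η : V [⋀^Fin (n + 1)]→L[ℝ] ℝ) : contract 0 η = 0 := by
  ext v
  exact η.map_coord_zero 0 rfl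

end Zero

end Charts

end G2

end

/-! ### The formula on the manifold and the characterisation of symmetries. -/

theorem mainTheorem10 {M : Type*} [TopologicalSpace M] [T2Space M] [SecondCountableTopology M]
    [ChartedSpace G2.E7 M] [IsManifold (𝓡 7) ∞ M]
    (φ : G2.Form M 3) (hφ : G2.IsG2Structure φ) (hclosed : φ.d = 0)
    (X : G2.VField M) (hX : X.IsSmooth) :
    G2.Form.lie X φ =
        (1 / 2 : ℝ) • G2.iPhiForm φ (G2.Tensor2.lie X (G2.assocMetric φ)) +
        (1 / 2 : ℝ) • G2.Form.contract
          (G2.sharpField φ (G2.codiff φ (G2.Form.contract X φ))) (G2.psiForm φ) ∧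
    (G2.IsSymmetry φ X ↔
      G2.IsKilling (G2.assocMetric φ) X ∧ G2.codiff φ (G2.Form.contract X φ) = 0) := by
  have hL : G2.Form.lie X φ =
      (1 / 2 : ℝ) • G2.iPhiForm φ (G2.Tensor2.lie X (G2.assocMetric φ)) +
      (1 / 2 : ℝ) • G2.Form.contract
        (G2.sharpField φ (G2.codiff φ (G2.Form.contract X φ))) (G2.psiForm φ) :=
    funext fun x => hφ.lie_apply hclosed hX x
  refine ⟨hL, fun h => ?_, fun ⟨hK, hC⟩ => ?_⟩
  · have h0 (x : M) := hφ.lie_eq_zero hclosed hX x (congrFun h x)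
    exact ⟨funext fun x => (h0 x).1, funext fun x => (h0 x).2⟩
  · have h1 (x : M) : G2.iPhiForm φ (G2.Tensor2.lie X (G2.assocMetric φ)) x = 0 := by
      rw [show G2.Tensor2.lie X (G2.assocMetric φ) = 0 from hK]
      exact G2.iPhi_zero _ _
    have h2 (x : M) : G2.Form.contract
        (G2.sharpField φ (G2.codiff φ (G2.Form.contract X φ))) (G2.psiForm φ) x = 0 := by
      rw [hC]
      exact (congrArg (fun v => G2.contract v (G2.psiForm φ x)) (G2.sharp_zero _ _)).trans
        (G2.contract_zero_left _)
    rw [G2.IsSymmetry, hL]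
    funext x
    rw [Pi.add_apply, Pi.smul_apply, Pi.smul_apply, h1, h2, smul_zero, add_zero]
    rfl
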